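/- Let $Q$ be a finite quiver without loops or oriented 2-cycles, with vertex set $Q_0=\{1,\dots,n\}$, and let $\mathcal{A}_Q\subset\mathbb{Q}(x_1,\dots,x_n)$ be its cluster algebra, i.e. the $\mathbb{Z}$-algebra generated by all cluster variables of all seeds obtained from the initial seed $((x_1,\dots,x_n),Q)$ by finite sequences of mutations; here mutation at $j$ replaces the current $x_j$ by $\bigl(\prod_{i\to j}x_i+\prod_{j\to i}x_i\bigr)/x_j$ (products over arrows) and mutates the quiver at $j$ in the usual way. By the Laurent phenomenon $\mathcal{A}_Q\subset\mathbb{Z}[x_1^{\pm1},\dots,x_n^{\pm1}]$. Let $\sigma$ be specialisation relations $x_j=a_j\in\{1,-1\}$ for the $j$ in a set $S\subseteq Q_0$ of size $m$, and let $\mathcal{A}_Q|_\sigma\subset\mathbb{Z}[x_i^{\pm1}: i\in Q_0\setminus S]$ be the specialised cluster algebra, i.e. the image of $\mathcal{A}_Q$ under the substitution $\sigma$. Its variables are the $x_i$ with $i\in Q_0\setminus S$. The variable $x_i$ is called polyamorous if every element of $\mathcal{A}_Q|_\sigma$ is polynomial in $x_i$ (that is, contains $x_i$ with nonnegative exponents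 only), and $\mathcal{A}_Q|_\sigma$ is called polyamorous if all its variables are. Let $B$ be the antisymmetric adjacency matrix of $Q$, with $B_{ij}=\#\{i\to j\}-\#\{j\to i\}$, let $M$ be the $(n-m)\times m$ submatrix of $B$ with rows indexed by $Q_0\setminus S$ and columns indexed by $S$, and let $\bar M$ be its reduction modulo $2$. Define $\mathbf{s}=(s_j)_{j\in S}\in(\mathbb{Z}/2\mathbb{Z})^{S}$ by $a_j=(-1)^{s_j}$, and let $\mathbf{u}\in(\mathbb{Z}/2\mathbb{Z})^{Q_0\setminus S}$ be the vector of all $1$s. Then $\mathcal{A}_Q|_\sigma$ is polyamorous if and only if both of the following conditions hold: 1. the vertices in $Q_0\setminus S$ form an independent set, i.e. no arrow of $Q$ joins two of them; 2. $\bar M\,\mathbf{s}=\mathbf{u}$ over $\mathbb{Z}/2\mathbb{Z}$. -/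

import Mathlib

/-!
Cluster algebras of finite quivers without loops or oriented 2-cycles, and their specialisations
at some initial cluster variables to `1` or `-1`.
-/

universe u w

namespace ClusterPoly

/-- The number of arrows `i → j` of a quiver with finitely many arrows. -/
noncomputable def arrowCount (V : Type u) [Quiver.{w} V] (i j : V) : ℕ := Nat.card (i ⟶ j)

/-- The antisymmetric adjacency matrix (exchange matrix) of a quiver. -/
noncomputable def adjMatrix (V : Type u) [Quiver.{w} V] : Matrix V V ℤ :=
  Matrix.of fun i j => (arrowCount V i j : ℤ) - (arrowCount V j i : ℤ)

/-- The graph in which two distinct vertices are adjacent when the quiver has an arrow between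
them, in either direction. -/
def underlyingGraph (V : Type u) [Quiver.{w} V] : SimpleGraph V :=
  SimpleGraph.fromRel fun i j : V => Nonempty (i ⟶ j)

/-- The ring `ℤ[x_v, x_v⁻¹ : v ∈ V]` of Laurent polynomials with integer coefficients: integer
combinations of the monomials `x^e`, for `e : V →₀ ℤ`. -/
abbrev Laurent (V : Type u) : Type u := AddMonoidAlgebra ℤ (V →₀ ℤ)

/-- The field `ℚ(x_v : v ∈ V)`, as the field of fractions of `ℤ[x_v, x_v⁻¹ : v ∈ V]`. -/
abbrev FunField (V : Type u) : Type u := FractionRing (Laurent V)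

/-- The variable `x_v` as a unit of the ring of Laurent polynomials. -/
noncomputable def Laurent.var {V : Type u} (v : V) : (Laurent V)ˣ where
  val := AddMonoidAlgebra.single (Finsupp.single v 1) 1
  inv := AddMonoidAlgebra.single (Finsupp.single v (-1)) 1
  val_inv := by
    rw [AddMonoidAlgebra.single_mul_single, ← Finsupp.single_add, AddMonoidAlgebra.one_def]
    simp
  inv_val := by
    rw [AddMonoidAlgebra.single_mul_single, ← Finsupp.single_add, AddMonoidAlgebra.one_def]
    simp

/-- Substitution of units `r v` of a commutative ring for the variables `x_v`:
`x^e ↦ ∏ v, r v ^ e v`, extended linearly. -/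
noncomputable def Laurent.eval {V : Type u} [Fintype V] {R : Type*} [CommRing R] (r : V → Rˣ) :
    Laurent V →+* R :=
  (AddMonoidAlgebra.lift ℤ R (V →₀ ℤ)
    { toFun := fun e => ((∏ v, r v ^ (Multiplicative.toAdd e) v : Rˣ) : R)
      map_one' := by simp
      map_mul' := by
        intro e f
        simp [zpow_add, Finset.prod_mul_distrib] }).toRingHom

/-- A quiver with vertex set `V`, given by its numbers of arrows `arrows i j` from `i` to `j`,
together with a cluster of rational functions. -/
structure Seed (V : Type u) where
  arrows : V → V → ℕ
  cluster : V → FunField V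

/-- The initial seed: the given quiver with the cluster of the variables `x_v`. -/
noncomputable def initialSeed (V : Type u) [Quiver.{w} V] : Seed V where
  arrows := arrowCount V
  cluster := fun v => algebraMap (Laurent V) (FunField V) (Laurent.var v)

/-- The number of arrows from `i` to `k`, with `i, k ≠ j`, after every path `i → j → k` has been
completed to a triangle by a new arrow `i → k`. -/
def completedArrows {V : Type u} (q : V → V → ℕ) (j i k : V) : ℕ := q i k + q i j * q j k

/-- Mutation of a quiver at `j`: arrows incident to `j` are reversed, the 2-paths through `j` are
completed, and a maximal set of 2-cycles is cancelled (this is the truncated subtraction). -/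
def mutateArrows {V : Type u} [DecidableEq V] (q : V → V → ℕ) (j i k : V) : ℕ :=
  if i = j ∨ k = j then q k i else completedArrows q j i k - completedArrows q j k i

/-- Mutation of a seed at `j`: the quiver is mutated at `j`, and the `j`-th cluster variable `x_j`
is replaced by `(∏_{i → j} x_i + ∏_{j → i} x_i) / x_j`, the products running over the arrows. -/
noncomputable def Seed.mutate {V : Type u} [Fintype V] [DecidableEq V] (s : Seed V) (j : V) :
    Seed V where
  arrows := mutateArrows s.arrows j
  cluster := Function.update s.cluster j
    ((∏ i, s.cluster i ^ s.arrows i j + ∏ i, s.cluster i ^ s.arrows j i) / s.cluster j)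

/-- The seeds of the cluster algebra: those obtained from the initial one by finitely many
mutations. -/
inductive IsSeed (V : Type u) [Fintype V] [DecidableEq V] [Quiver.{w} V] : Seed V → Prop
  | initial : IsSeed V (initialSeed V)
  | mutate (s : Seed V) (j : V) : IsSeed V s → IsSeed V (s.mutate j)

/-- The set of all cluster variables, from all clusters. -/
def clusterVariables (V : Type u) [Fintype V] [DecidableEq V] [Quiver.{w} V] : Set (FunField V) :=
  {y | ∃ s : Seed V, IsSeed V s ∧ ∃ i, y = s.cluster i}

/-- The cluster algebra: the `ℤ`-subalgebra (that is, subring) of `ℚ(x_v : v ∈ V)` generated by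
all cluster variables. -/
noncomputable def clusterAlgebra (V : Type u) [Fintype V] [DecidableEq V] [Quiver.{w} V] :
    Subring (FunField V) :=
  Subring.closure (clusterVariables V)

/-- The specialisation `x_j = a j` for `j ∈ S`, as a homomorphism from Laurent polynomials in all
variables to Laurent polynomials in the variables that are not specialised. -/
noncomputable def specialise {V : Type u} [Fintype V] [DecidableEq V] (S : Finset V)
    (a : S → ℤˣ) : Laurent V →+* Laurent {v : V // v ∉ S} :=
  Laurent.eval fun v =>
    if h : v ∈ S then Units.map (Int.castRingHom (Laurent {v : V // v ∉ S})) (a ⟨v, h⟩)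
    else Laurent.var ⟨v, h⟩

/-- The specialised cluster algebra: the image under the specialisation of the cluster algebra,
regarded as a ring of Laurent polynomials. (By the Laurent phenomenon every element of the cluster
algebra is a Laurent polynomial with integer coefficients, so the preimage under the inclusion
`ℤ[x_v, x_v⁻¹] ⊆ ℚ(x_v)` is the whole cluster algebra.) -/
noncomputable def specialisedClusterAlgebra (V : Type u) [Fintype V] [DecidableEq V]
    [Quiver.{w} V] (S : Finset V) (a : S → ℤˣ) : Subring (Laurent {v : V // v ∉ S}) :=
  ((clusterAlgebra V).comap (algebraMap (Laurent V) (FunField V))).map (specialise S a)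

/-- A Laurent polynomial is polynomial in the variable `x_u` if `x_u` occurs in it with
nonnegative exponents only. -/
def Laurent.IsPolynomialIn {U : Type u} (f : Laurent U) (v : U) : Prop :=
  ∀ e ∈ f.coeff.support, 0 ≤ e v

/-- A variable of the specialised cluster algebra is polyamorous if all elements of the algebra
are polynomial in it. -/
def IsPolyamorousVariable (V : Type u) [Fintype V] [DecidableEq V] [Quiver.{w} V] (S : Finset V)
    (a : S → ℤˣ) (v : {v : V // v ∉ S}) : Prop :=
  ∀ f ∈ specialisedClusterAlgebra V S a, Laurent.IsPolynomialIn f v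

/-- The specialised cluster algebra is polyamorous if all its variables are. -/
def IsPolyamorous (V : Type u) [Fintype V] [DecidableEq V] [Quiver.{w} V] (S : Finset V)
    (a : S → ℤˣ) : Prop :=
  ∀ v : {v : V // v ∉ S}, IsPolyamorousVariable V S a v

/-- The submatrix of the antisymmetric adjacency matrix whose rows are the vertices that are not
specialised and whose columns are the specialised ones, reduced modulo `2`. -/
noncomputable def specialisationMatrix (V : Type u) [Quiver.{w} V] (S : Finset V) :
    Matrix {v : V // v ∉ S} S (ZMod 2) :=
  ((adjMatrix V).submatrix (fun i : {v : V // v ∉ S} => (i : V)) (fun j : S => (j : V))).map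
    (Int.cast : ℤ → ZMod 2)

end ClusterPoly

/-!
Write `P_v = ∏_{i → v} x_i + ∏_{v → i} x_i` for the exchange binomial at `v`. Everything rests on
the fact that a variable `x_v` is polyamorous if and only if `P_v` specialises to `0`
(`isPolyamorousVariable_iff`). As the quiver has no loops or oriented 2-cycles, the two monomials of
`P_v` have no variable in common, so they cancel after specialisation exactly when neither of them
contains a variable that is not specialised and they receive opposite signs. These are the two
conditions of the theorem, read off at `v`.

If `x_v` is polyamorous, then `P_v` specialises to `0` because `P_v / x_v` is a cluster variable and
`P_v` does not involve `x_v`. For the converse one needs that every element `f` of the cluster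
algebra is a Laurent polynomial in the cluster `(x_i (i ≠ v), P_v / x_v)`. Then the part of `f` with
negative exponents in `x_v` is divisible by `P_v` (`exists_dvd_isPolynomialIn_of_mem_laurent`), and
it vanishes under the specialisation.

So the work lies in the Laurent phenomenon, for the seed obtained by mutation at `v`. It is proved
through upper bounds. The upper bound of a seed consists of the elements that are Laurent
polynomials in its cluster and in all adjacent clusters; it contains the cluster of the seed. Let
`L_j`, `L_k`, `L_kj` be the rings of Laurent polynomials in the clusters obtained by mutation at
`j`, at `k`, and at `k` followed by `j`. If the exchange matrix is nonsingular, then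
`L_j ∩ L_k ⊆ L_kj`. Indeed, an element `f` of `L_j ∩ L_k` satisfies `p ^ N * f ∈ L_kj` and
`q ^ M * f ∈ L_kj` for suitable `p` and `q` in `L_kj`, and the point is that `q` is not a zero
divisor modulo `p` (`RegularMod.mem`). If no arrow joins `j` and `k`, these elements are the
exchange binomials at `j` and `k`, which are coprime as the corresponding columns of the exchange
matrix are linearly independent (`binomial_dvd_of_dvd_mul`). If `j` and `k` are joined by arrows,
coprimality comes from a computation in two variables (`regularMod_of_rank_two`). Hence all seeds
have the same upper bound, and it contains all cluster variables.

An arbitrary quiver is reduced to the nonsingular case by adding a new vertex with a single arrow to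
each old vertex, and setting the new variables equal to `1`
(`Seed.Reaches.cluster_mem_laurent_of_isProper`).
-/

namespace ClusterPoly

open Function

/-! ### Laurent polynomials and their evaluation -/

section Eval

variable {V : Type u} [Fintype V] {R : Type*} [CommRing R]

/-- The Laurent monomial `∏ v, r v ^ e v` in units `r v`. -/
def monomialUnit (r : V → Rˣ) (e : V → ℤ) : Rˣ := ∏ v, r v ^ e v

lemma Laurent.eval_single (r : V → Rˣ) (e : V →₀ ℤ) (c : ℤ) :
    Laurent.eval r (AddMonoidAlgebra.single e c) = c * (monomialUnit r e : R) := by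
  simp [Laurent.eval, AddMonoidAlgebra.lift_single, monomialUnit]

@[simp]
lemma Laurent.eval_var (r : V → Rˣ) (v : V) :
    Laurent.eval r (Laurent.var v : (Laurent V)ˣ) = r v := by
  classical
  rw [Laurent.var, Laurent.eval_single, monomialUnit, Finset.prod_eq_single v]
  · simp
  · intro b _ hb
    simp [hb.symm]
  · simp

lemma map_monomialUnit {R' : Type*} [CommRing R'] (φ : R →+* R') (r : V → Rˣ) (e : V → ℤ) :
    φ (monomialUnit r e) = (monomialUnit (fun v => Units.map (φ : R →* R') (r v)) e : R'ˣ) := by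
  have : Units.map (φ : R →* R') (monomialUnit r e) =
      monomialUnit (fun v => Units.map (φ : R →* R') (r v)) e := by
    simp [monomialUnit, map_prod, map_zpow]
  rw [← this]
  rfl

lemma Laurent.single_eq_monomialUnit (e : V →₀ ℤ) :
    (AddMonoidAlgebra.single e 1 : Laurent V) = (monomialUnit Laurent.var e : (Laurent V)ˣ) := by
  have h : ∀ (v : V) (n : ℤ), ((Laurent.var v ^ n : (Laurent V)ˣ) : Laurent V) =
      AddMonoidAlgebra.single (Finsupp.single v n) 1 := by
    intro v n
    obtain ⟨m, rfl | rfl⟩ := n.eq_nat_or_neg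
    · rw [zpow_natCast, Units.val_pow_eq_pow_val, Laurent.var, AddMonoidAlgebra.single_pow]
      simp
    · rw [zpow_neg, zpow_natCast, ← inv_pow, Units.val_pow_eq_pow_val]
      change (AddMonoidAlgebra.single (Finsupp.single v (-1)) 1 : Laurent V) ^ m = _
      rw [AddMonoidAlgebra.single_pow]
      simp
  rw [monomialUnit, Units.coe_prod, Finset.prod_congr rfl fun v _ => h v (e v),
    AddMonoidAlgebra.prod_single, Finset.prod_const_one]
  congr 1
  exact (Finsupp.univ_sum_single e).symm

lemma Laurent.hom_ext {f g : Laurent V →+* R}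
    (h : ∀ v, f (Laurent.var v : (Laurent V)ˣ) = g (Laurent.var v : (Laurent V)ˣ)) : f = g := by
  refine AddMonoidAlgebra.ringHom_ext (fun r => ?_) fun e => ?_
  · have : (AddMonoidAlgebra.single 0 r : Laurent V) = (r : Laurent V) := by
      rw [AddMonoidAlgebra.intCast_def]; simp
    rw [this, map_intCast, map_intCast]
  · rw [Laurent.single_eq_monomialUnit, map_monomialUnit, map_monomialUnit]
    congr 3
    ext v
    exact h v

lemma Laurent.eval_monomialUnit (r : V → Rˣ) (e : V → ℤ) :
    Laurent.eval r (monomialUnit Laurent.var e : (Laurent V)ˣ) = (monomialUnit r e : R) := by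
  rw [map_monomialUnit]
  congr 3
  ext v
  simp

lemma monomialUnit_natCast (r : V → Rˣ) (e : V → ℕ) :
    ((monomialUnit r fun v => (e v : ℤ) : Rˣ) : R) = ∏ v, (r v : R) ^ e v := by
  simp [monomialUnit]

end Eval

/-! ### Coprime binomials -/

section Coprime

/-- In `R[T, T⁻¹]`, a sum of two monomials of different degrees with unit coefficients is not a
zero divisor. -/
lemma eq_zero_of_binomial_mul_eq_zero {R : Type*} [CommRing R] (c d : Rˣ) {a b : ℤ} (hab : a ≠ b)
    (F : LaurentPolynomial R)
    (h : (AddMonoidAlgebra.single a (c : R) + AddMonoidAlgebra.single b (d : R)) * F = 0) :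
    F = 0 := by
  wlog hlt : a < b generalizing a b c d
  · exact this d c hab.symm (by rwa [add_comm]) (lt_of_le_of_ne (not_lt.mp hlt) hab.symm)
  by_contra hF
  have hne : F.coeff.support.Nonempty := by
    rw [Finsupp.support_nonempty_iff]
    simpa using hF
  -- The coefficient of the product in the top degree is `d` times the leading coefficient of `F`.
  set n := F.coeff.support.max' hne with hn
  have h1 : F.coeff (n + (b - a)) = 0 := by
    by_contra h0
    have := F.coeff.support.le_max' _ (Finsupp.mem_support_iff.mpr h0)
    omega
  have h2 : F.coeff n ≠ 0 := Finsupp.mem_support_iff.mp (F.coeff.support.max'_mem hne)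
  have h3 := congrArg (fun G : LaurentPolynomial R => G.coeff (b + n)) h
  simp only [add_mul, AddMonoidAlgebra.coeff_add, Finsupp.add_apply,
    AddMonoidAlgebra.coeff_single_mul_apply, AddMonoidAlgebra.coeff_zero, Finsupp.zero_apply] at h3
  rw [show -a + (b + n) = n + (b - a) by ring, show -b + (b + n) = n by ring, h1, mul_zero,
    zero_add] at h3
  exact h2 ((Units.mul_right_eq_zero d).mp h3)

variable {V : Type u} [Fintype V]

/-- The unit `T` of the ring of Laurent polynomials in one variable. -/
noncomputable def unitT (R : Type*) [CommRing R] : (LaurentPolynomial R)ˣ where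
  val := .T 1
  inv := .T (-1)
  val_inv := by rw [← LaurentPolynomial.T_add]; rfl
  inv_val := by rw [← LaurentPolynomial.T_add]; rfl

lemma unitT_zpow (R : Type*) [CommRing R] (n : ℤ) :
    (unitT R ^ n : (LaurentPolynomial R)ˣ).val = .T n := by
  obtain ⟨m, rfl | rfl⟩ := n.eq_nat_or_neg
  · rw [zpow_natCast, Units.val_pow_eq_pow_val]
    simp [unitT]
  · rw [zpow_neg, zpow_natCast, ← inv_pow, Units.val_pow_eq_pow_val]
    change LaurentPolynomial.T (-1) ^ m = _
    simp

/-- If a grading of the Laurent polynomial ring, with `deg x_v = l v`, makes the binomial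
`x^e₁ + x^e₂` homogeneous but not `x^e₃ + x^e₄`, the latter is not a zero divisor modulo the
former: the grading embeds the quotient ring into its Laurent polynomials in a variable `T`, and
there `x^e₃ + x^e₄` becomes a sum of two monomials of different degrees. The quotient ring enters
through its projection `π`. -/
lemma map_eq_zero_of_weight {R : Type*} [CommRing R] (π : Laurent V →+* R)
    (l e₁ e₂ e₃ e₄ : V → ℤ)
    (h12 : ∑ v, l v * e₁ v = ∑ v, l v * e₂ v) (h34 : ∑ v, l v * e₃ v ≠ ∑ v, l v * e₄ v)
    {p : Laurent V}
    (hp : p = (monomialUnit Laurent.var e₁ : (Laurent V)ˣ) + (monomialUnit Laurent.var e₂).val)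
    (hπp : π p = 0) {g : Laurent V}
    (hg : p ∣ ((monomialUnit Laurent.var e₃ : (Laurent V)ˣ) + (monomialUnit Laurent.var e₄).val) *
        g) :
    π g = 0 := by
  let x : V → Rˣ := fun v => Units.map (π : Laurent V →* R) (Laurent.var v)
  let r : V → (LaurentPolynomial R)ˣ := fun v =>
    Units.map (LaurentPolynomial.C : R →+* LaurentPolynomial R).toMonoidHom (x v) * unitT R ^ l v
  have hr : ∀ e : V → ℤ, (monomialUnit r e).val =
      AddMonoidAlgebra.single (∑ v, l v * e v) (monomialUnit x e : R) := by
    intro e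
    have : monomialUnit r e =
        Units.map (LaurentPolynomial.C : R →+* LaurentPolynomial R).toMonoidHom
          (monomialUnit x e) * unitT R ^ (∑ v, l v * e v) := by
      have hz : unitT R ^ (∑ v, l v * e v) = ∏ v, unitT R ^ (l v * e v) := by
        classical
        induction (Finset.univ : Finset V) using Finset.induction_on with
        | empty => simp
        | insert v s hv ih => rw [Finset.sum_insert hv, Finset.prod_insert hv, zpow_add, ih]
      rw [hz, monomialUnit, monomialUnit, map_prod, ← Finset.prod_mul_distrib]
      refine Finset.prod_congr rfl fun v _ => ?_
      simp only [r, mul_zpow, map_zpow, zpow_mul]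
    rw [this, Units.val_mul, unitT_zpow, LaurentPolynomial.single_eq_C_mul_T]
    rfl
  have hπ : ∀ e : V → ℤ, π (monomialUnit Laurent.var e : (Laurent V)ˣ) = (monomialUnit x e : R) :=
    fun e => map_monomialUnit π _ e
  have hp0 : Laurent.eval r p = 0 := by
    rw [hp, map_add, Laurent.eval_monomialUnit, Laurent.eval_monomialUnit, hr, hr, h12,
      ← AddMonoidAlgebra.single_add, ← hπ, ← hπ, ← map_add, ← hp, hπp,
      AddMonoidAlgebra.single_zero]
  have hg0 : Laurent.eval r g = 0 := by
    obtain ⟨h, hh⟩ := hg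
    have := congrArg (Laurent.eval r) hh
    rw [map_mul, map_mul, hp0, zero_mul, map_add, Laurent.eval_monomialUnit,
      Laurent.eval_monomialUnit, hr, hr] at this
    exact eq_zero_of_binomial_mul_eq_zero _ _ h34 _ this
  -- Setting `T = 1` recovers `π`.
  let ε : LaurentPolynomial R →+* R := LaurentPolynomial.eval₂ (RingHom.id R) 1
  have hε : ε.comp (Laurent.eval r) = π := Laurent.hom_ext fun v => by
    have h1 : (r v : LaurentPolynomial R) = LaurentPolynomial.C (x v : R) * .T (l v) := by
      simp only [r, Units.val_mul, unitT_zpow]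
      rfl
    rw [RingHom.comp_apply, Laurent.eval_var, h1]
    simp only [ε, LaurentPolynomial.eval₂_C_mul_T]
    simp [x]
  rw [← hε, RingHom.comp_apply, hg0, map_zero]

/-- Two binomials with linearly independent exponent differences are coprime, in the sense that
each is not a zero divisor modulo the other. -/
lemma binomial_dvd_of_dvd_mul (e₁ e₂ e₃ e₄ : V → ℤ) (i j : V)
    (hij : (e₁ i - e₂ i) * (e₃ j - e₄ j) ≠ (e₁ j - e₂ j) * (e₃ i - e₄ i)) {g : Laurent V}
    {p : Laurent V}
    (hp : p = (monomialUnit Laurent.var e₁ : (Laurent V)ˣ) + (monomialUnit Laurent.var e₂).val)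
    (hg : p ∣ ((monomialUnit Laurent.var e₃ : (Laurent V)ˣ) + (monomialUnit Laurent.var e₄).val) *
        g) :
    p ∣ g := by
  classical
  have key : ∀ e : V → ℤ, ∑ v, ((if v = j then e₁ i - e₂ i else 0) -
      (if v = i then e₁ j - e₂ j else 0)) * e v = (e₁ i - e₂ i) * e j - (e₁ j - e₂ j) * e i := by
    intro e
    simp [sub_mul, Finset.sum_sub_distrib, ite_mul]
  rw [← Ideal.mem_span_singleton, ← Ideal.Quotient.eq_zero_iff_mem]
  refine map_eq_zero_of_weight _
    (fun v => (if v = j then e₁ i - e₂ i else 0) - (if v = i then e₁ j - e₂ j else 0))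
    e₁ e₂ e₃ e₄ ?_ ?_ hp
    (Ideal.Quotient.eq_zero_iff_mem.mpr (Ideal.mem_span_singleton_self p)) hg
  · rw [key, key]; ring
  · rw [key, key]
    intro h
    apply hij
    linear_combination h

end Coprime

/-! ### Laurent rings of clusters, and division in a subring of a field -/

section LaurentSubring

variable {W : Type u} {K : Type*} [Field K]

/-- The subring `ℤ[y i, (y i)⁻¹]` of a field `K`. -/
def laurentSubring (y : W → K) : Subring K :=
  Subring.closure (Set.range y ∪ Set.range fun i => (y i)⁻¹)

lemma self_mem_laurentSubring (y : W → K) (i : W) : y i ∈ laurentSubring y :=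
  Subring.subset_closure (Or.inl ⟨i, rfl⟩)

lemma inv_mem_laurentSubring (y : W → K) (i : W) : (y i)⁻¹ ∈ laurentSubring y :=
  Subring.subset_closure (Or.inr ⟨i, rfl⟩)

lemma laurentSubring_le {y : W → K} {T : Subring K} (h : ∀ i, y i ∈ T ∧ (y i)⁻¹ ∈ T) :
    laurentSubring y ≤ T := by
  refine Subring.closure_le.mpr ?_
  rintro _ (⟨i, rfl⟩ | ⟨i, rfl⟩)
  · exact (h i).1
  · exact (h i).2

lemma inv_prod_pow_mem {T : Subring K} {y : W → K} {s : Finset W} {e : W → ℕ}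
    (h : ∀ i ∈ s, e i ≠ 0 → (y i)⁻¹ ∈ T) : (∏ i ∈ s, y i ^ e i)⁻¹ ∈ T := by
  rw [← Finset.prod_inv_distrib]
  refine T.prod_mem fun i hi => ?_
  rcases eq_or_ne (e i) 0 with h0 | h0
  · simp [h0, T.one_mem]
  · rw [← inv_pow]
    exact T.pow_mem (h i hi h0) _

lemma prod_pow_mem {T : Subring K} {y : W → K} {s : Finset W} {e : W → ℕ}
    (h : ∀ i ∈ s, e i ≠ 0 → y i ∈ T) : ∏ i ∈ s, y i ^ e i ∈ T := by
  refine T.prod_mem fun i hi => ?_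
  rcases eq_or_ne (e i) 0 with h0 | h0
  · simp [h0, T.one_mem]
  · exact T.pow_mem (h i hi h0) _

/-- The elements `f` of the field with `p ^ N * f ∈ L` for some `N`, that is, `L[1/p]`. -/
def awaySubring (L : Subring K) {p : K} (hp : p ∈ L) : Subring K where
  carrier := {f | ∃ N : ℕ, p ^ N * f ∈ L}
  mul_mem' := by
    rintro f g ⟨N, hN⟩ ⟨M, hM⟩
    exact ⟨N + M, by convert L.mul_mem hN hM using 1; ring⟩
  one_mem' := ⟨0, by simp [L.one_mem]⟩
  add_mem' := by
    rintro f g ⟨N, hN⟩ ⟨M, hM⟩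
    refine ⟨N + M, ?_⟩
    convert L.add_mem (L.mul_mem (L.pow_mem hp M) hN) (L.mul_mem (L.pow_mem hp N) hM) using 1
    ring
  zero_mem' := ⟨0, by simp [L.zero_mem]⟩
  neg_mem' := by
    rintro f ⟨N, hN⟩
    exact ⟨N, by convert L.neg_mem hN using 1; ring⟩

lemma le_awaySubring (L : Subring K) {p : K} (hp : p ∈ L) : L ≤ awaySubring L hp :=
  fun f hf => ⟨0, by simpa using hf⟩

/-- Multiplication by `q` is injective on `L / pL`. Divisibility by `p` in the subring `L` is
expressed by division in the field. -/
def RegularMod (L : Subring K) (p q : K) : Prop := ∀ g ∈ L, q * g / p ∈ L → g / p ∈ L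

lemma RegularMod.mul {L : Subring K} {p q q' : K} (h : RegularMod L p q) (h' : RegularMod L p q')
    (hq' : q' ∈ L) : RegularMod L p (q * q') := fun g hg hqg =>
  h' g hg (h (q' * g) (L.mul_mem hq' hg) (by rwa [← mul_assoc]))

lemma RegularMod.of_inv_mem {L : Subring K} (p : K) {q : K} (h0 : q ≠ 0) (h : q⁻¹ ∈ L) :
    RegularMod L p q := fun g _ hqg => by
  have : g / p = q⁻¹ * (q * g / p) := by field_simp
  rw [this]
  exact L.mul_mem h hqg

lemma RegularMod.add_mul {L : Subring K} {p q h : K} (hp : p ≠ 0) (hq : RegularMod L p q)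
    (hh : h ∈ L) : RegularMod L p (q + p * h) := fun g hg hqg => by
  refine hq g hg ?_
  have : q * g / p = (q + p * h) * g / p - h * g := by field_simp; ring
  rw [this]
  exact L.sub_mem hqg (L.mul_mem hh hg)

lemma RegularMod.pow {L : Subring K} {p q : K} (h : RegularMod L p q) (hq : q ∈ L) (n : ℕ) :
    RegularMod L p (q ^ n) := by
  induction n with
  | zero => intro g _ hg; simpa using hg
  | succ n ih => rw [pow_succ]; exact ih.mul h hq

/-- `L[1/p] ∩ L[1/q] = L` when `q` is not a zero divisor modulo `p`. -/
lemma RegularMod.mem {L : Subring K} {p q : K} (h : RegularMod L p q) (hp0 : p ≠ 0) (hp : p ∈ L)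
    (hq : q ∈ L) {f : K} (hfp : f ∈ awaySubring L hp) (hfq : f ∈ awaySubring L hq) : f ∈ L := by
  obtain ⟨N, hN⟩ := hfp
  obtain ⟨M, hM⟩ := hfq
  induction N with
  | zero => simpa using hN
  | succ N ih =>
    refine ih ?_
    have h1 : p ^ N * f = p ^ (N + 1) * f / p := by field_simp; ring
    rw [h1]
    refine h.pow hq M _ hN ?_
    have h2 : q ^ M * (p ^ (N + 1) * f) / p = p ^ N * (q ^ M * f) := by field_simp; ring
    rw [h2]
    exact L.mul_mem (L.pow_mem hp N) hM

end LaurentSubring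

/-! ### Free clusters -/

section Free

variable {W : Type u} [Fintype W] {K : Type*} [Field K]

/-- A family of nonzero elements of a field that are algebraically independent, in the form that no
nonzero Laurent polynomial vanishes on them. -/
structure IsFree (y : W → K) : Prop where
  ne_zero : ∀ i, y i ≠ 0
  injective : Injective (Laurent.eval fun i => Units.mk0 (y i) (ne_zero i))

lemma range_eval_eq_laurentSubring (r : W → Kˣ) :
    (Laurent.eval r).range = laurentSubring fun i => (r i : K) := by
  apply le_antisymm
  · rintro _ ⟨f, rfl⟩
    induction f using AddMonoidAlgebra.induction_linear with
    | zero => rw [map_zero]; exact Subring.zero_mem _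
    | add f g hf hg => rw [map_add]; exact Subring.add_mem _ hf hg
    | single e c =>
      rw [Laurent.eval_single]
      refine Subring.mul_mem _ (intCast_mem _ _) ?_
      rw [monomialUnit, Units.coe_prod]
      refine Subring.prod_mem _ fun i _ => ?_
      obtain ⟨m, hm | hm⟩ := (e i).eq_nat_or_neg
      · rw [hm, zpow_natCast, Units.val_pow_eq_pow_val]
        exact Subring.pow_mem _ (self_mem_laurentSubring (fun i => (r i : K)) i) _
      · rw [hm, zpow_neg, zpow_natCast, ← inv_pow, Units.val_pow_eq_pow_val,
          Units.val_inv_eq_inv_val]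
        exact Subring.pow_mem _ (inv_mem_laurentSubring (fun i => (r i : K)) i) _
  · refine laurentSubring_le fun i => ⟨⟨Laurent.var i, by simp⟩,
      ⟨((Laurent.var i)⁻¹ : (Laurent W)ˣ), ?_⟩⟩
    have : Units.map (Laurent.eval r : Laurent W →* K) (Laurent.var i) = r i := by
      ext; simp
    rw [← Units.val_inv_eq_inv_val, ← this, ← map_inv]
    rfl

lemma mem_laurentSubring_iff {y : W → K} (hy : ∀ i, y i ≠ 0) {f : K} :
    f ∈ laurentSubring y ↔ ∃ g, Laurent.eval (fun i => Units.mk0 (y i) (hy i)) g = f := by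
  have := range_eval_eq_laurentSubring fun i => Units.mk0 (y i) (hy i)
  simp only [Units.val_mk0] at this
  rw [← this, RingHom.mem_range]

lemma add_monomialUnit_ne_zero (e₁ e₂ : W → ℤ) :
    (monomialUnit Laurent.var e₁ : (Laurent W)ˣ) + (monomialUnit Laurent.var e₂).val ≠ 0 := by
  intro h
  have := congrArg (Laurent.eval fun _ => (1 : ℤˣ)) h
  rw [map_add, Laurent.eval_monomialUnit, Laurent.eval_monomialUnit, map_zero] at this
  simp [monomialUnit] at this

lemma eval_add_monomialUnit {R : Type*} [CommRing R] (r : W → Rˣ) (e₁ e₂ : W → ℕ) :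
    Laurent.eval r ((monomialUnit Laurent.var fun i => (e₁ i : ℤ) : (Laurent W)ˣ) +
        (monomialUnit Laurent.var fun i => (e₂ i : ℤ)).val) =
      ∏ i, (r i : R) ^ e₁ i + ∏ i, (r i : R) ^ e₂ i := by
  rw [map_add, Laurent.eval_monomialUnit, Laurent.eval_monomialUnit, monomialUnit_natCast,
    monomialUnit_natCast]

lemma IsFree.add_prod_pow_ne_zero {y : W → K} (hy : IsFree y) (e₁ e₂ : W → ℕ) :
    ∏ i, y i ^ e₁ i + ∏ i, y i ^ e₂ i ≠ 0 := by
  have := eval_add_monomialUnit (fun i => Units.mk0 (y i) (hy.ne_zero i)) e₁ e₂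
  simp only [Units.val_mk0] at this
  rw [← this, map_ne_zero_iff _ hy.injective]
  exact add_monomialUnit_ne_zero _ _

/-- Two binomials with linearly independent exponent differences are coprime. -/
lemma IsFree.regularMod {y : W → K} (hy : IsFree y) (e₁ e₂ e₃ e₄ : W → ℕ) (i j : W)
    (hij : ((e₁ i : ℤ) - e₂ i) * ((e₃ j : ℤ) - e₄ j) ≠
      ((e₁ j : ℤ) - e₂ j) * ((e₃ i : ℤ) - e₄ i)) :
    RegularMod (laurentSubring y) (∏ i, y i ^ e₁ i + ∏ i, y i ^ e₂ i)
      (∏ i, y i ^ e₃ i + ∏ i, y i ^ e₄ i) := by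
  intro g hg hqg
  have hp0 := hy.add_prod_pow_ne_zero e₁ e₂
  have hp := eval_add_monomialUnit (fun i => Units.mk0 (y i) (hy.ne_zero i)) e₁ e₂
  have hq := eval_add_monomialUnit (fun i => Units.mk0 (y i) (hy.ne_zero i)) e₃ e₄
  simp only [Units.val_mk0] at hp hq
  rw [mem_laurentSubring_iff hy.ne_zero] at hg hqg
  obtain ⟨G, rfl⟩ := hg
  obtain ⟨H, hH⟩ := hqg
  rw [eq_div_iff hp0, ← hp, ← hq, ← map_mul, ← map_mul] at hH
  obtain ⟨F, hF⟩ := binomial_dvd_of_dvd_mul _ _ _ _ i j hij rfl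
    ⟨H, (hy.injective hH).symm.trans (mul_comm _ _)⟩
  rw [mem_laurentSubring_iff hy.ne_zero]
  refine ⟨F, ?_⟩
  rw [eq_div_iff hp0, ← hp, ← map_mul, mul_comm F, ← hF]

/-- Replacing `y k` by `p / y k`, for a binomial `p` in the other variables, keeps a family free:
the corresponding substitution is an involution of the ring of Laurent polynomials with `p`
inverted. -/
lemma IsFree.update [DecidableEq W] {y : W → K} (hy : IsFree y) (k : W) (e₁ e₂ : W → ℕ)
    (h₁ : e₁ k = 0) (h₂ : e₂ k = 0) :
    IsFree (Function.update y k ((∏ i, y i ^ e₁ i + ∏ i, y i ^ e₂ i) / y k)) := by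
  have hp0 := hy.add_prod_pow_ne_zero e₁ e₂
  set pK := ∏ i, y i ^ e₁ i + ∏ i, y i ^ e₂ i with hpK
  have h0 : ∀ i, Function.update y k (pK / y k) i ≠ 0 := by
    intro i
    rcases eq_or_ne i k with rfl | hi
    · simpa using ⟨hp0, hy.ne_zero _⟩
    · simpa [hi] using hy.ne_zero i
  refine ⟨h0, ?_⟩
  set p : Laurent W := (monomialUnit Laurent.var fun i => (e₁ i : ℤ) : (Laurent W)ˣ) +
    (monomialUnit Laurent.var fun i => (e₂ i : ℤ)).val with hp
  have hpne : p ≠ 0 := add_monomialUnit_ne_zero _ _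
  let A := Localization.Away p
  let ι : Laurent W →+* A := algebraMap _ _
  have hι : Injective ι := IsLocalization.injective A
    (powers_le_nonZeroDivisors_of_noZeroDivisors hpne)
  let x : W → Aˣ := fun i => Units.map (ι : Laurent W →* A) (Laurent.var i)
  obtain ⟨P, hP⟩ : IsUnit (ι p) := IsLocalization.Away.algebraMap_isUnit p
  let r : W → Aˣ := Function.update x k (P * (x k)⁻¹)
  have hprod : ∀ e : W → ℕ, e k = 0 → ∏ i, (r i : A) ^ e i = ∏ i, (x i : A) ^ e i := by
    intro e he
    refine Finset.prod_congr rfl fun i _ => ?_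
    rcases eq_or_ne i k with rfl | hi
    · rw [he, pow_zero, pow_zero]
    · simp [r, hi]
  have hιp : ι p = ∏ i, (x i : A) ^ e₁ i + ∏ i, (x i : A) ^ e₂ i := by
    rw [← eval_add_monomialUnit x]
    have : ι = Laurent.eval x := Laurent.hom_ext fun v => by simp [x]
    rw [this]
  have hψp : Laurent.eval r p = ι p :=
    (eval_add_monomialUnit r e₁ e₂).trans (by rw [hprod e₁ h₁, hprod e₂ h₂, hιp])
  have hψu : IsUnit (Laurent.eval r p) := by rw [hψp]; exact ⟨P, hP⟩
  let ψ : A →+* A := IsLocalization.Away.lift p hψu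
  have hψ : ∀ f, ψ (ι f) = Laurent.eval r f := fun f => IsLocalization.Away.lift_eq p hψu f
  have hψx : ∀ i, Units.map (ψ : A →* A) (x i) = r i := fun i => by
    ext
    change ψ (ι (Laurent.var i : (Laurent W)ˣ)) = r i
    rw [hψ, Laurent.eval_var]
  have hψP : Units.map (ψ : A →* A) P = P := by
    ext
    change ψ P = P
    rw [hP, hψ, hψp]
  have hψψ : ψ.comp ψ = RingHom.id A := by
    refine IsLocalization.ringHom_ext (Submonoid.powers p) (Laurent.hom_ext fun i => ?_)
    change ψ (ψ (x i)) = x i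
    have : Units.map (ψ : A →* A) (Units.map (ψ : A →* A) (x i)) = x i := by
      rw [hψx]
      rcases eq_or_ne i k with rfl | hi
      · simp only [r, Function.update_self, map_mul, map_inv, hψP, hψx]
        rw [mul_inv_rev, inv_inv, mul_comm, mul_assoc, inv_mul_cancel, mul_one]
      · simp only [r, Function.update_of_ne hi, hψx]
    exact congrArg Units.val this
  have hψinj : Injective ψ :=
    (show LeftInverse ψ ψ from fun a => DFunLike.congr_fun hψψ a).injective
  let u : W → Kˣ := fun i => Units.mk0 (y i) (hy.ne_zero i)
  have hup : Laurent.eval u p = pK := by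
    rw [hp, eval_add_monomialUnit]
    rfl
  have hθu : IsUnit (Laurent.eval u p) := by rw [hup]; exact hp0.isUnit
  let θ : A →+* K := IsLocalization.Away.lift p hθu
  have hθ : ∀ f, θ (ι f) = Laurent.eval u f := fun f => IsLocalization.Away.lift_eq p hθu f
  have hθinj : Injective θ := by
    refine (injective_iff_map_eq_zero θ).mpr fun a ha => ?_
    obtain ⟨n, f, hf⟩ := IsLocalization.Away.surj p a
    have h3 : θ (ι f) = 0 := by
      rw [show ι f = a * ι p ^ n from hf.symm, map_mul, ha, zero_mul]
    rw [hθ, map_eq_zero_iff _ hy.injective] at h3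
    rw [h3, map_zero] at hf
    exact (((show IsUnit (ι p) from ⟨P, hP⟩).pow n).mul_left_eq_zero).mp hf
  have hcomp : Laurent.eval (fun i => Units.mk0 _ (h0 i)) = (θ.comp ψ).comp ι := by
    refine Laurent.hom_ext fun i => ?_
    rw [Laurent.eval_var, RingHom.comp_apply, RingHom.comp_apply, hψ, Laurent.eval_var]
    have hθx : ∀ i, Units.map (θ : A →* K) (x i) = u i := fun i => by
      ext
      change θ (ι (Laurent.var i : (Laurent W)ˣ)) = u i
      rw [hθ, Laurent.eval_var]
    have hθP : θ P = pK := by rw [hP, hθ, hup]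
    have : Units.map (θ : A →* K) (r i) = Units.mk0 _ (h0 i) := by
      rcases eq_or_ne i k with rfl | hi
      · ext
        simp only [r, Function.update_self, map_mul, map_inv, hθx]
        simp [u, div_eq_mul_inv, hθP]
      · ext
        simp only [r, Function.update_of_ne hi, hθx]
        simp [u]
    exact (congrArg Units.val this).symm
  rw [hcomp]
  exact (hθinj.comp hψinj).comp hι

end Free

/-! ### Mutation of quivers -/

section Arrows

variable {W : Type u}

/-- A quiver without loops or oriented 2-cycles. -/
def IsTwoAcyclic (q : W → W → ℕ) : Prop := ∀ i j, q i j = 0 ∨ q j i = 0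

lemma IsTwoAcyclic.self {q : W → W → ℕ} (hq : IsTwoAcyclic q) (i : W) : q i i = 0 :=
  (hq i i).elim id id

/-- The entries of the exchange matrix of a quiver. -/
def netArrows (q : W → W → ℕ) (i j : W) : ℤ := q i j - q j i

/-- The exchange matrix of the quiver is nonsingular. -/
def IsNonsingular [Fintype W] (q : W → W → ℕ) : Prop :=
  ∀ c : W → ℤ, (∀ i, ∑ j, netArrows q i j * c j = 0) → c = 0

/-- Some `2 × 2` minor of two columns of a nonsingular matrix does not vanish. -/
lemma IsNonsingular.exists_minor_ne [Fintype W] [DecidableEq W] {q : W → W → ℕ}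
    (hq : IsNonsingular q) {j k : W} (hjk : j ≠ k) :
    ∃ i l, netArrows q i j * netArrows q l k ≠ netArrows q l j * netArrows q i k := by
  by_contra! h
  have h0 : ∀ l, netArrows q l j = 0 := by
    intro l
    have := hq (Pi.single k (netArrows q l j) - Pi.single j (netArrows q l k)) fun i => by
      simp only [Pi.sub_apply, mul_sub, Finset.sum_sub_distrib, Pi.single_apply, mul_ite, mul_zero,
        Finset.sum_ite_eq', Finset.mem_univ, if_true]
      linear_combination -h i l
    simpa [hjk.symm] using congrFun this k
  have := hq (Pi.single j 1) fun i => by simp [Pi.single_apply, h0]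
  simpa using congrFun this j

variable [DecidableEq W]

lemma IsTwoAcyclic.mutateArrows {q : W → W → ℕ} (hq : IsTwoAcyclic q) (k : W) :
    IsTwoAcyclic (mutateArrows q k) := by
  intro i l
  by_cases h : i = k ∨ l = k
  · simpa [ClusterPoly.mutateArrows, h, Or.comm] using hq l i
  · simp only [ClusterPoly.mutateArrows, h, if_false, Or.comm (a := l = k)]
    omega

lemma mutateArrows_left (q : W → W → ℕ) (k i : W) : mutateArrows q k k i = q i k := by
  simp [mutateArrows]

lemma mutateArrows_right (q : W → W → ℕ) (k i : W) : mutateArrows q k i k = q k i := by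
  simp [mutateArrows]

lemma mutateArrows_of_ne (q : W → W → ℕ) {k i l : W} (hi : i ≠ k) (hl : l ≠ k) :
    mutateArrows q k i l = q i l + q i k * q k l - (q l i + q l k * q k i) := by
  simp [mutateArrows, completedArrows, hi, hl]

lemma netArrows_mutateArrows {q : W → W → ℕ} {k i l : W} (hi : i ≠ k) (hl : l ≠ k) :
    netArrows (mutateArrows q k) i l = netArrows q i l + q i k * q k l - q l k * q k i := by
  rw [netArrows, mutateArrows_of_ne q hi hl, mutateArrows_of_ne q hl hi, netArrows]
  have h1 : (q i k : ℤ) * q k l = ((q i k * q k l : ℕ) : ℤ) := by push_cast; ring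
  have h2 : (q l k : ℤ) * q k i = ((q l k * q k i : ℕ) : ℤ) := by push_cast; ring
  rw [h1, h2]
  generalize q i k * q k l = a
  generalize q l k * q k i = b
  omega

lemma mutateArrows_mutateArrows {q : W → W → ℕ} (hq : IsTwoAcyclic q) (k : W) :
    mutateArrows (mutateArrows q k) k = q := by
  ext i l
  by_cases hi : i = k
  · subst hi
    rw [mutateArrows_left, mutateArrows_right]
  by_cases hl : l = k
  · subst hl
    rw [mutateArrows_right, mutateArrows_left]
  rw [mutateArrows_of_ne _ hi hl, mutateArrows_of_ne _ hi hl, mutateArrows_of_ne _ hl hi]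
  simp only [mutateArrows_left, mutateArrows_right]
  rw [mul_comm (q k i), mul_comm (q k l)]
  generalize q i k * q k l = a
  generalize q l k * q k i = b
  have := hq i l
  omega

/-- Mutation changes the exchange matrix by invertible row and column operations. -/
lemma IsNonsingular.mutateArrows [Fintype W] {q : W → W → ℕ} (hq2 : IsTwoAcyclic q)
    (hq : IsNonsingular q) (k : W) : IsNonsingular (mutateArrows q k) := by
  intro c hc
  have hkk := hq2.self k
  have hrow : ∑ l, netArrows q k l * c l = 0 := by
    have := hc k
    simp only [netArrows, mutateArrows_left, mutateArrows_right] at this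
    rw [← neg_eq_zero, ← this, ← Finset.sum_neg_distrib]
    exact Finset.sum_congr rfl fun l _ => by rw [netArrows]; ring
  have hentry : ∀ i l, i ≠ k → netArrows (ClusterPoly.mutateArrows q k) i l =
      netArrows q i l + q i k * netArrows q k l + netArrows q i k * q l k -
        if l = k then 2 * netArrows q i k else 0 := by
    intro i l hi
    by_cases hl : l = k
    · subst hl
      simp only [netArrows, mutateArrows_left, mutateArrows_right, hkk, if_true]
      push_cast
      ring
    · rw [netArrows_mutateArrows hi hl, if_neg hl]
      simp only [netArrows]
      ring
  -- The column operation: only the `k`-th coordinate of the vector changes.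
  set d : ℤ := -2 * c k + ∑ l, (q l k : ℤ) * c l with hd
  have hc' := hq (c + Pi.single k d) fun i => by
    simp only [Pi.add_apply, mul_add, Finset.sum_add_distrib, Pi.single_apply, mul_ite, mul_zero,
      Finset.sum_ite_eq', Finset.mem_univ, if_true]
    by_cases hi : i = k
    · subst hi
      rw [hrow, netArrows]
      ring
    · have h1 := hc i
      simp only [hentry i _ hi, sub_mul, add_mul, Finset.sum_sub_distrib, Finset.sum_add_distrib,
        mul_assoc, ← Finset.mul_sum, ite_mul, zero_mul, Finset.sum_ite_eq', Finset.mem_univ,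
        if_true, hrow] at h1
      rw [hd]
      linear_combination h1
  have hne : ∀ l, l ≠ k → c l = 0 := fun l hl => by simpa [hl] using congrFun hc' l
  have hsum : ∑ l, (q l k : ℤ) * c l = 0 := Finset.sum_eq_zero fun l _ => by
    by_cases hl : l = k
    · rw [hl, hkk]; simp
    · rw [hne l hl, mul_zero]
  ext l
  by_cases hl : l = k
  · have h2 := congrFun hc' k
    simp only [Pi.add_apply, Pi.single_eq_same, Pi.zero_apply] at h2
    rw [hl, Pi.zero_apply]
    omega
  · exact hne l hl

end Arrows

/-! ### Mutation of seeds -/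

section Seeds

lemma prod_pow_congr_of_ne {W : Type*} {K : Type*} [Field K] {x y : W → K} {e f : W → ℕ}
    {s : Finset W} (h : ∀ i ∈ s, e i = f i ∧ (e i ≠ 0 → x i = y i)) :
    ∏ i ∈ s, x i ^ e i = ∏ i ∈ s, y i ^ f i := by
  refine Finset.prod_congr rfl fun i hi => ?_
  rcases eq_or_ne (e i) 0 with h0 | h0
  · rw [← (h i hi).1, h0, pow_zero, pow_zero]
  · rw [(h i hi).2 h0, (h i hi).1]

lemma Seed.eq_of_arrows_of_cluster {W : Type u} {s t : Seed W} (h1 : s.arrows = t.arrows)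
    (h2 : s.cluster = t.cluster) : s = t := by
  cases s
  cases t
  simp_all

variable {W : Type u} [Fintype W]

/-- A seed whose quiver has no loops or oriented 2-cycles and whose cluster is free. -/
structure Seed.IsProper (s : Seed W) : Prop where
  twoAcyclic : IsTwoAcyclic s.arrows
  free : IsFree s.cluster

/-- The numerator of the exchange relation at `j`. -/
noncomputable def Seed.exchange (s : Seed W) (j : W) : FunField W :=
  ∏ i, s.cluster i ^ s.arrows i j + ∏ i, s.cluster i ^ s.arrows j i

lemma Seed.IsProper.exchange_ne_zero {s : Seed W} (hs : s.IsProper) (j : W) :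
    s.exchange j ≠ 0 :=
  hs.free.add_prod_pow_ne_zero _ _

/-- The seed with all arrows reversed. -/
def Seed.op (s : Seed W) : Seed W where
  arrows := fun i j => s.arrows j i
  cluster := s.cluster

lemma Seed.IsProper.op {s : Seed W} (hs : s.IsProper) : s.op.IsProper :=
  ⟨fun i j => hs.twoAcyclic j i, hs.free⟩

variable [DecidableEq W]

lemma Seed.mutate_cluster_self (s : Seed W) (j : W) :
    (s.mutate j).cluster j = s.exchange j / s.cluster j := by
  simp [Seed.mutate, Seed.exchange]

lemma Seed.mutate_cluster_of_ne (s : Seed W) {j i : W} (h : i ≠ j) :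
    (s.mutate j).cluster i = s.cluster i := by
  simp [Seed.mutate, h]

lemma Seed.mutate_arrows (s : Seed W) (j : W) :
    (s.mutate j).arrows = mutateArrows s.arrows j := rfl

lemma Seed.IsProper.mutate {s : Seed W} (hs : s.IsProper) (j : W) : (s.mutate j).IsProper :=
  ⟨hs.twoAcyclic.mutateArrows j,
    hs.free.update j _ _ (hs.twoAcyclic.self j) (hs.twoAcyclic.self j)⟩

lemma Seed.IsProper.exchange_mutate {s : Seed W} (hs : s.IsProper) (j : W) :
    (s.mutate j).exchange j = s.exchange j := by
  have hx : ∀ e : W → ℕ, e j = 0 →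
      ∏ i, (s.mutate j).cluster i ^ e i = ∏ i, s.cluster i ^ e i := fun e he =>
    prod_pow_congr_of_ne fun i _ => ⟨rfl, fun hi =>
      s.mutate_cluster_of_ne fun h => hi (h ▸ he)⟩
  rw [Seed.exchange, Seed.exchange, Seed.mutate_arrows]
  simp only [mutateArrows_left, mutateArrows_right]
  rw [hx (fun i => s.arrows j i) (hs.twoAcyclic.self j),
    hx (fun i => s.arrows i j) (hs.twoAcyclic.self j), add_comm]

lemma Seed.IsProper.mutate_mutate {s : Seed W} (hs : s.IsProper) (j : W) :
    (s.mutate j).mutate j = s := by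
  have h1 : ((s.mutate j).mutate j).arrows = s.arrows := mutateArrows_mutateArrows hs.twoAcyclic j
  have h2 : ((s.mutate j).mutate j).cluster = s.cluster := by
    ext i
    by_cases hi : i = j
    · subst hi
      rw [Seed.mutate_cluster_self, Seed.mutate_cluster_self, hs.exchange_mutate]
      have := hs.exchange_ne_zero i
      have := hs.free.ne_zero i
      field_simp
    · rw [Seed.mutate_cluster_of_ne _ hi, Seed.mutate_cluster_of_ne _ hi]
  exact Seed.eq_of_arrows_of_cluster h1 h2

lemma Seed.op_mutate (s : Seed W) (j : W) : s.op.mutate j = (s.mutate j).op := by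
  have h1 : (s.op.mutate j).arrows = (s.mutate j).op.arrows := by
    ext i l
    simp only [Seed.op, Seed.mutate, mutateArrows, completedArrows, Or.comm, mul_comm]
  have h2 : (s.op.mutate j).cluster = (s.mutate j).op.cluster := by
    simp only [Seed.op, Seed.mutate, add_comm]
  exact Seed.eq_of_arrows_of_cluster h1 h2

end Seeds

/-! ### The Laurent phenomenon for nonsingular exchange matrices -/

section RankTwo

variable {K : Type*} [Field K]

/-- The computation in two variables behind the Laurent phenomenon. Here `(xj, xk)` are cluster
variables joined by `b > 0` arrows `k → j`; mutation at `k` replaces `xk` by `z`, a subsequent one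
at `j` replaces `xj` by `w = p / xj`, and mutation of the initial cluster at `j` replaces `xj` by
`xj'`. Modulo `p`, the variable `xj'` is up to a unit `M w + A E` if `b = 1` and `M w` if `b ≥ 2`,
and `z * xk` is the unit `D`. -/
lemma regularMod_of_rank_two {L : Subring K} {xj xk xj' z w A C D E M p : K} {b : ℕ} (hb : b ≠ 0)
    (hzk : z * xk = D + xj ^ b * E) (hjj : xj * xj' = xk ^ b * A + C) (hjw : xj * w = p)
    (hMp : M * p = A * D ^ b + z ^ b * C) (hp0 : p ≠ 0) (hz0 : z ≠ 0) (hw0 : w ≠ 0)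
    (hM0 : M ≠ 0) (hD0 : D ≠ 0)
    (hz : z ∈ L) (hz' : z⁻¹ ∈ L) (hw : w ∈ L) (hw' : w⁻¹ ∈ L) (hA : A ∈ L) (hD : D ∈ L)
    (hD' : D⁻¹ ∈ L) (hE : E ∈ L) (hM : M ∈ L) (hM' : M⁻¹ ∈ L) (hp : p ∈ L)
    (hreg : b = 1 → RegularMod L p (M * w + A * E)) :
    xj' ∈ L ∧ RegularMod L p (xj' * (z * xk)) := by
  have hxj0 : xj ≠ 0 := by
    rintro rfl
    exact hp0 (by rw [← hjw, zero_mul])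
  have hxjw : xj = p * w⁻¹ := by rw [← hjw]; field_simp
  have hxj : xj ∈ L := by rw [hxjw]; exact L.mul_mem hp hw'
  have hPk : z * xk ∈ L := by rw [hzk]; exact L.add_mem hD (L.mul_mem (L.pow_mem hxj b) hE)
  obtain ⟨e, h, he, hh, heq, hrege⟩ : ∃ e h : K, e ∈ L ∧ h ∈ L ∧
      (z * xk) ^ b - D ^ b = xj * (e + xj * h) ∧ RegularMod L p (M * w + A * e) := by
    obtain rfl | hb2 : b = 1 ∨ 2 ≤ b := by omega
    · exact ⟨E, 0, hE, L.zero_mem, by rw [hzk]; ring, hreg rfl⟩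
    · obtain ⟨c, rfl⟩ : ∃ c, b = c + 2 := ⟨b - 2, by omega⟩
      have hs : ∑ i ∈ Finset.range (c + 2), (z * xk) ^ i * D ^ (c + 2 - 1 - i) ∈ L :=
        L.sum_mem fun i _ => L.mul_mem (L.pow_mem hPk _) (L.pow_mem hD _)
      refine ⟨0, xj ^ c * E * ∑ i ∈ Finset.range (c + 2), (z * xk) ^ i * D ^ (c + 2 - 1 - i),
        L.zero_mem, L.mul_mem (L.mul_mem (L.pow_mem hxj c) hE) hs, ?_, ?_⟩
      · rw [← (Commute.all (z * xk) D).geom_sum₂_mul, show z * xk - D = xj ^ (c + 2) * E by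
          rw [hzk]; ring]
        ring
      · rw [mul_zero, add_zero]
        exact RegularMod.of_inv_mem p (mul_ne_zero hM0 hw0) (by
          rw [mul_inv]; exact L.mul_mem hM' hw')
  have hxj' : xj' = z⁻¹ ^ b * ((M * w + A * e) + p * (w⁻¹ * A * h)) := by
    have h1 : xj * (z ^ b * xj') = xj * ((M * w + A * e) + p * (w⁻¹ * A * h)) := by
      have h2 : p * w⁻¹ = xj := hxjw.symm
      calc xj * (z ^ b * xj') = z ^ b * (xj * xj') := by ring
        _ = A * ((z * xk) ^ b - D ^ b) + M * p := by rw [hjj, hMp]; ring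
        _ = xj * (M * w + A * e + (p * w⁻¹) * (A * h)) := by rw [heq, h2, ← hjw]; ring
        _ = _ := by ring
    rw [← mul_left_cancel₀ hxj0 h1, ← mul_assoc, ← mul_pow, inv_mul_cancel₀ hz0, one_pow, one_mul]
  have hcorr : w⁻¹ * A * h ∈ L := L.mul_mem (L.mul_mem hw' hA) hh
  have hxjL : xj' ∈ L := by
    rw [hxj']
    exact L.mul_mem (L.pow_mem hz' b) (L.add_mem (L.add_mem (L.mul_mem hM hw) (L.mul_mem hA he))
      (L.mul_mem hp hcorr))
  refine ⟨hxjL, RegularMod.mul ?_ ?_ hPk⟩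
  · rw [hxj']
    refine RegularMod.mul (RegularMod.of_inv_mem p (pow_ne_zero b (inv_ne_zero hz0)) ?_)
      (hrege.add_mul hp0 hcorr) ?_
    · rw [inv_pow, inv_inv]
      exact L.pow_mem hz b
    · exact L.add_mem (L.add_mem (L.mul_mem hM hw) (L.mul_mem hA he)) (L.mul_mem hp hcorr)
  · obtain ⟨c, rfl⟩ : ∃ c, b = c + 1 := ⟨b - 1, by omega⟩
    have : z * xk = D + p * (w⁻¹ * xj ^ c * E) := by
      calc z * xk = D + xj * (xj ^ c * E) := by rw [hzk]; ring
        _ = D + p * w⁻¹ * (xj ^ c * E) := by rw [← hxjw]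
        _ = _ := by ring
    rw [this]
    exact (RegularMod.of_inv_mem p hD0 hD').add_mul hp0
      (L.mul_mem (L.mul_mem hw' (L.pow_mem hxj c)) hE)

end RankTwo

section UpperBound

variable {W : Type u} [Fintype W] [DecidableEq W]

/-- The ring of Laurent polynomials in the cluster of a seed. -/
noncomputable def Seed.laurent (s : Seed W) : Subring (FunField W) := laurentSubring s.cluster

lemma Seed.laurent_mutate_le (s : Seed W) (j : W) {T : Subring (FunField W)}
    (h : ∀ i, i ≠ j → s.cluster i ∈ T ∧ (s.cluster i)⁻¹ ∈ T)
    (hj : s.exchange j / s.cluster j ∈ T) (hj' : (s.exchange j / s.cluster j)⁻¹ ∈ T) :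
    (s.mutate j).laurent ≤ T := by
  refine laurentSubring_le fun i => ?_
  by_cases hi : i = j
  · subst hi
    rw [s.mutate_cluster_self]
    exact ⟨hj, hj'⟩
  · rw [s.mutate_cluster_of_ne hi]
    exact h i hi

/-- For vertices `j`, `k` not joined by an arrow, the ring is cut out by the two coprime exchange
binomials. -/
lemma Seed.inf_laurent_le_of_arrows_eq_zero {s : Seed W} (hs : s.IsProper)
    (hn : IsNonsingular s.arrows) {j k : W} (hjk : j ≠ k) (h1 : s.arrows k j = 0)
    (h2 : s.arrows j k = 0) :
    (s.mutate k).laurent ⊓ (s.mutate j).laurent ≤ ((s.mutate k).mutate j).laurent := by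
  set t := (s.mutate k).mutate j with ht
  have htp : t.IsProper := (hs.mutate k).mutate j
  have hti : ∀ i, i ≠ j → i ≠ k → t.cluster i = s.cluster i := fun i hij hik => by
    rw [ht, Seed.mutate_cluster_of_ne _ hij, Seed.mutate_cluster_of_ne _ hik]
  have htk : t.cluster k = s.exchange k / s.cluster k := by
    rw [ht, Seed.mutate_cluster_of_ne _ hjk.symm, Seed.mutate_cluster_self]
  have hq : ∀ i, (s.mutate k).arrows i j = s.arrows i j ∧
      (s.mutate k).arrows j i = s.arrows j i := by
    intro i
    rw [s.mutate_arrows]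
    by_cases hi : i = k
    · subst hi
      rw [mutateArrows_left, mutateArrows_right, h1, h2]
      exact ⟨rfl, rfl⟩
    · rw [mutateArrows_of_ne _ hi hjk, mutateArrows_of_ne _ hjk hi, h1, h2]
      have := hs.twoAcyclic i j
      simp only [zero_mul, mul_zero]
      omega
  have hex : (s.mutate k).exchange j = s.exchange j := by
    refine congrArg₂ (· + ·) (prod_pow_congr_of_ne fun i _ => ⟨(hq i).1, fun h0 => ?_⟩)
      (prod_pow_congr_of_ne fun i _ => ⟨(hq i).2, fun h0 => ?_⟩)
    · exact s.mutate_cluster_of_ne fun h => h0 (by rw [(hq i).1, h, h1])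
    · exact s.mutate_cluster_of_ne fun h => h0 (by rw [(hq i).2, h, h2])
  have htj : t.cluster j = s.exchange j / s.cluster j := by
    rw [ht, Seed.mutate_cluster_self, hex, Seed.mutate_cluster_of_ne _ hjk]
  have hprod : ∀ e : W → ℕ, e j = 0 → e k = 0 →
      ∏ i, s.cluster i ^ e i = ∏ i, t.cluster i ^ e i := fun e hej hek =>
    prod_pow_congr_of_ne fun i _ => ⟨rfl, fun h0 =>
      (hti i (fun h => h0 (h ▸ hej)) fun h => h0 (h ▸ hek)).symm⟩
  have hjj := hs.twoAcyclic.self j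
  have hkk := hs.twoAcyclic.self k
  have hexj : s.exchange j = ∏ i, t.cluster i ^ s.arrows i j + ∏ i, t.cluster i ^ s.arrows j i := by
    rw [Seed.exchange, hprod (fun i => s.arrows i j) hjj h1,
      hprod (fun i => s.arrows j i) hjj h2]
  have hexk : s.exchange k = ∏ i, t.cluster i ^ s.arrows i k + ∏ i, t.cluster i ^ s.arrows k i := by
    rw [Seed.exchange, hprod (fun i => s.arrows i k) h2 hkk,
      hprod (fun i => s.arrows k i) h1 hkk]
  have hmem : ∀ i, t.cluster i ∈ t.laurent := self_mem_laurentSubring t.cluster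
  have hinv : ∀ i, (t.cluster i)⁻¹ ∈ t.laurent := inv_mem_laurentSubring t.cluster
  have hpj : s.exchange j ∈ t.laurent := by
    rw [hexj]
    exact Subring.add_mem _ (prod_pow_mem fun i _ _ => hmem i) (prod_pow_mem fun i _ _ => hmem i)
  have hpk : s.exchange k ∈ t.laurent := by
    rw [hexk]
    exact Subring.add_mem _ (prod_pow_mem fun i _ _ => hmem i) (prod_pow_mem fun i _ _ => hmem i)
  have hreg : RegularMod t.laurent (s.exchange j) (s.exchange k) := by
    obtain ⟨i, l, hil⟩ := hn.exists_minor_ne hjk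
    rw [hexj, hexk]
    exact htp.free.regularMod _ _ _ _ i l hil
  have hj0 := hs.exchange_ne_zero j
  have hk0 := hs.exchange_ne_zero k
  have hxj0 := hs.free.ne_zero j
  have hxk0 := hs.free.ne_zero k
  rintro f ⟨hfk, hfj⟩
  refine hreg.mem hj0 hpj hpk (s.laurent_mutate_le k ?_ ?_ ?_ hfk)
    (s.laurent_mutate_le j ?_ ?_ ?_ hfj)
  · intro i hik
    by_cases hij : i = j
    · subst hij
      refine ⟨le_awaySubring _ hpj ?_, 1, ?_⟩
      · have : s.cluster i = s.exchange i * (t.cluster i)⁻¹ := by rw [htj]; field_simp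
        rw [this]
        exact Subring.mul_mem _ hpj (hinv i)
      · have : s.exchange i ^ 1 * (s.cluster i)⁻¹ = t.cluster i := by rw [htj]; field_simp
        rw [this]
        exact hmem i
    · rw [← hti i hij hik]
      exact ⟨le_awaySubring _ hpj (hmem i), le_awaySubring _ hpj (hinv i)⟩
  · rw [← htk]; exact le_awaySubring _ hpj (hmem k)
  · rw [← htk]; exact le_awaySubring _ hpj (hinv k)
  · intro i hij
    by_cases hik : i = k
    · subst hik
      refine ⟨le_awaySubring _ hpk ?_, 1, ?_⟩
      · have : s.cluster i = s.exchange i * (t.cluster i)⁻¹ := by rw [htk]; field_simp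
        rw [this]
        exact Subring.mul_mem _ hpk (hinv i)
      · have : s.exchange i ^ 1 * (s.cluster i)⁻¹ = t.cluster i := by rw [htk]; field_simp
        rw [this]
        exact hmem i
    · rw [← hti i hij hik]
      exact ⟨le_awaySubring _ hpk (hmem i), le_awaySubring _ hpk (hinv i)⟩
  · rw [← htj]; exact le_awaySubring _ hpk (hmem j)
  · rw [← htj]; exact le_awaySubring _ hpk (hinv j)

/-- For vertices joined by arrows `k → j`, no condition on the exchange matrix is needed: the two
elements that cut out the ring are the numerator of the exchange relation at `j` after mutation at
`k`, and the product of the exchange binomial at `k` with the cluster variable that replaces `x_j`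
when the initial seed is mutated at `j`. -/
lemma Seed.inf_laurent_le_of_arrows_ne_zero {s : Seed W} (hs : s.IsProper) {j k : W}
    (hjk : j ≠ k) (h1 : s.arrows k j ≠ 0) :
    (s.mutate k).laurent ⊓ (s.mutate j).laurent ≤ ((s.mutate k).mutate j).laurent := by
  set t := (s.mutate k).mutate j with ht
  have htp : t.IsProper := (hs.mutate k).mutate j
  have h2 : s.arrows j k = 0 := (hs.twoAcyclic j k).resolve_right h1
  have hjj := hs.twoAcyclic.self j
  have hkk := hs.twoAcyclic.self k
  set q := s.arrows with hq
  set x := s.cluster with hx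
  set q' := (s.mutate k).arrows with hq'
  have hti : ∀ i, i ≠ j → i ≠ k → t.cluster i = x i := fun i hij hik => by
    rw [ht, Seed.mutate_cluster_of_ne _ hij, Seed.mutate_cluster_of_ne _ hik]
  have htk : t.cluster k = s.exchange k / x k := by
    rw [ht, Seed.mutate_cluster_of_ne _ hjk.symm, Seed.mutate_cluster_self]
  have htj : t.cluster j = (s.mutate k).exchange j / x j := by
    rw [ht, Seed.mutate_cluster_self, Seed.mutate_cluster_of_ne _ hjk]
  have hmem : ∀ i, t.cluster i ∈ t.laurent := self_mem_laurentSubring t.cluster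
  have hinv : ∀ i, (t.cluster i)⁻¹ ∈ t.laurent := inv_mem_laurentSubring t.cluster
  have hxmem : ∀ i, i ≠ j → i ≠ k → x i ∈ t.laurent := fun i hij hik => by
    rw [← hti i hij hik]; exact hmem i
  have hxinv : ∀ i, i ≠ j → i ≠ k → (x i)⁻¹ ∈ t.laurent := fun i hij hik => by
    rw [← hti i hij hik]; exact hinv i
  have hx0 : ∀ i, x i ≠ 0 := hs.free.ne_zero
  have ht0 : ∀ i, t.cluster i ≠ 0 := htp.free.ne_zero
  have hPk0 : s.exchange k ≠ 0 := hs.exchange_ne_zero k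
  have hPj0 : s.exchange j ≠ 0 := hs.exchange_ne_zero j
  have hp0 : (s.mutate k).exchange j ≠ 0 := (hs.mutate k).exchange_ne_zero j
  -- The monomials of the exchange relations, and the monomial cancelled by mutation at `k`.
  let m : W → ℕ := fun i => min (q i j + q i k * q k j) (q j i)
  let A := ∏ i ∈ Finset.univ.erase k, x i ^ q i j
  let C := ∏ i, x i ^ q j i
  let D := ∏ i, x i ^ q i k
  let E := ∏ i ∈ Finset.univ.erase j, x i ^ q k i
  let M := ∏ i ∈ Finset.univ.erase k, x i ^ m i
  have hmj : m j = 0 := by simp [m, hjj]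
  have hq'1 : ∀ i, i ≠ k → q' i j + m i = q i j + q i k * q k j := by
    intro i hi
    rw [hq', Seed.mutate_arrows, mutateArrows_of_ne _ hi hjk]
    simp only [← hq, h2, zero_mul, add_zero, m]
    omega
  have hq'2 : ∀ i, i ≠ k → q' j i + m i = q j i := by
    intro i hi
    rw [hq', Seed.mutate_arrows, mutateArrows_of_ne _ hjk hi]
    simp only [← hq, h2, zero_mul, add_zero, m]
    omega
  have hq'kj : q' k j = 0 := by rw [hq', Seed.mutate_arrows, mutateArrows_left]; exact h2
  have hq'jk : q' j k = q k j := by rw [hq', Seed.mutate_arrows, mutateArrows_right]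
  have hq'jj : q' j j = 0 := (hs.mutate k).twoAcyclic.self j
  have hex : (s.mutate k).exchange j =
      ∏ i, t.cluster i ^ q' i j + ∏ i, t.cluster i ^ q' j i := by
    refine congrArg₂ (· + ·) (prod_pow_congr_of_ne fun i _ => ⟨rfl, fun h0 => ?_⟩)
      (prod_pow_congr_of_ne fun i _ => ⟨rfl, fun h0 => ?_⟩)
    · rw [ht, Seed.mutate_cluster_of_ne _ fun h : i = j => h0 (by rw [h]; exact hq'jj)]
    · rw [ht, Seed.mutate_cluster_of_ne _ fun h : i = j => h0 (by rw [h]; exact hq'jj)]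
  have hMj : ∀ e : W → ℕ, e j = 0 → ∏ i ∈ Finset.univ.erase k, t.cluster i ^ e i =
      ∏ i ∈ Finset.univ.erase k, x i ^ e i := fun e he => by
    refine prod_pow_congr_of_ne fun i hi => ⟨rfl, fun h0 => hti i (fun h => h0 (h ▸ he)) ?_⟩
    exact Finset.ne_of_mem_erase hi
  have hDk : D = ∏ i ∈ Finset.univ.erase k, x i ^ q i k := by
    simp only [D]
    rw [← Finset.mul_prod_erase _ _ (Finset.mem_univ k), hkk, pow_zero, one_mul]
  have hCk : C = ∏ i ∈ Finset.univ.erase k, x i ^ q j i := by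
    simp only [C]
    rw [← Finset.mul_prod_erase _ _ (Finset.mem_univ k), h2, pow_zero, one_mul]
  have hMp : M * (s.mutate k).exchange j = A * D ^ q k j + t.cluster k ^ q k j * C := by
    rw [hex, ← Finset.mul_prod_erase _ _ (Finset.mem_univ k),
      ← Finset.mul_prod_erase _ (fun i => t.cluster i ^ q' j i) (Finset.mem_univ k), hq'kj, hq'jk,
      pow_zero, one_mul, hMj (fun i => q' i j) hq'jj, hMj (fun i => q' j i) hq'jj, mul_add, hDk,
      hCk, mul_left_comm]
    simp only [A, M]
    rw [← Finset.prod_pow, ← Finset.prod_mul_distrib, ← Finset.prod_mul_distrib,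
      ← Finset.prod_mul_distrib]
    refine congrArg₂ (· + ·) (Finset.prod_congr rfl fun i hi => ?_)
      (congrArg _ (Finset.prod_congr rfl fun i hi => ?_))
    · rw [← pow_add, add_comm, hq'1 i (Finset.ne_of_mem_erase hi), pow_add, pow_mul]
    · rw [← pow_add, add_comm, hq'2 i (Finset.ne_of_mem_erase hi)]
  have hzk : t.cluster k * x k = D + x j ^ q k j * E := by
    rw [htk, div_mul_cancel₀ _ (hx0 k)]
    simp only [D, E]
    rw [Finset.mul_prod_erase _ (fun i => x i ^ q k i) (Finset.mem_univ j)]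
    rfl
  have hjj' : x j * (s.exchange j / x j) = x k ^ q k j * A + C := by
    rw [mul_div_cancel₀ _ (hx0 j)]
    simp only [A, C]
    rw [Finset.mul_prod_erase _ (fun i => x i ^ q i j) (Finset.mem_univ k)]
    rfl
  have hjw : x j * t.cluster j = (s.mutate k).exchange j := by
    rw [htj, mul_div_cancel₀ _ (hx0 j)]
  have hxprod0 : ∀ (S : Finset W) (e : W → ℕ), ∏ i ∈ S, x i ^ e i ≠ 0 := fun S e =>
    Finset.prod_ne_zero_iff.mpr fun i _ => pow_ne_zero _ (hx0 i)
  have hp : (s.mutate k).exchange j ∈ t.laurent := by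
    rw [hex]
    exact Subring.add_mem _ (prod_pow_mem fun i _ _ => hmem i) (prod_pow_mem fun i _ _ => hmem i)
  have hDne : ∀ i, q i k ≠ 0 → i ≠ j ∧ i ≠ k := fun i h0 =>
    ⟨fun h => h0 (h ▸ h2), fun h => h0 (h ▸ hkk)⟩
  have hD : D ∈ t.laurent := prod_pow_mem fun i _ h0 => hxmem i (hDne i h0).1 (hDne i h0).2
  have hD' : D⁻¹ ∈ t.laurent := inv_prod_pow_mem fun i _ h0 => hxinv i (hDne i h0).1 (hDne i h0).2
  have hMne : ∀ i ∈ Finset.univ.erase k, m i ≠ 0 → i ≠ j ∧ i ≠ k := fun i hi h0 =>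
    ⟨fun h => h0 (h ▸ hmj), Finset.ne_of_mem_erase hi⟩
  have hM : M ∈ t.laurent := prod_pow_mem fun i hi h0 => hxmem i (hMne i hi h0).1 (hMne i hi h0).2
  have hM' : M⁻¹ ∈ t.laurent :=
    inv_prod_pow_mem fun i hi h0 => hxinv i (hMne i hi h0).1 (hMne i hi h0).2
  have hA : A ∈ t.laurent := prod_pow_mem fun i hi h0 =>
    hxmem i (fun h => h0 (h ▸ hjj)) (Finset.ne_of_mem_erase hi)
  have hE : E ∈ t.laurent := prod_pow_mem fun i hi h0 =>
    hxmem i (Finset.ne_of_mem_erase hi) (fun h => h0 (h ▸ hkk))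
  have hreg : q k j = 1 →
      RegularMod t.laurent ((s.mutate k).exchange j) (M * t.cluster j + A * E) := by
    intro hb
    -- Both summands are monomials in the cluster of `t`, and only the first involves its `j`-th
    -- variable.
    let e₃ : W → ℕ := fun i => if i = k then 0 else if i = j then 1 else m i
    let e₄ : W → ℕ := fun i => if i = k then 0 else if i = j then 0 else q i j + q k i
    have hsplit : ∀ e : W → ℕ, e k = 0 → ∏ i, t.cluster i ^ e i =
        t.cluster j ^ e j * ∏ i ∈ (Finset.univ.erase k).erase j, x i ^ e i := by
      intro e he
      rw [← Finset.mul_prod_erase _ _ (Finset.mem_univ k), he, pow_zero, one_mul,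
        ← Finset.mul_prod_erase _ _ (Finset.mem_erase.mpr ⟨hjk, Finset.mem_univ j⟩)]
      refine congrArg _ (Finset.prod_congr rfl fun i hi => ?_)
      rw [hti i (Finset.ne_of_mem_erase hi) (Finset.ne_of_mem_erase (Finset.mem_of_mem_erase hi))]
    have h₃ : M * t.cluster j = ∏ i, t.cluster i ^ e₃ i := by
      rw [hsplit e₃ (by simp [e₃])]
      simp only [M]
      rw [← Finset.mul_prod_erase _ _ (Finset.mem_erase.mpr ⟨hjk, Finset.mem_univ j⟩), hmj,
        pow_zero, one_mul, mul_comm]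
      refine congrArg₂ (· * ·) (by simp [e₃, hjk]) (Finset.prod_congr rfl fun i hi => ?_)
      simp [e₃, Finset.ne_of_mem_erase hi, Finset.ne_of_mem_erase (Finset.mem_of_mem_erase hi)]
    have h₄ : A * E = ∏ i, t.cluster i ^ e₄ i := by
      rw [hsplit e₄ (by simp [e₄])]
      simp only [A, E]
      rw [← Finset.mul_prod_erase _ _ (Finset.mem_erase.mpr ⟨hjk, Finset.mem_univ j⟩), hjj,
        pow_zero, one_mul,
        ← Finset.mul_prod_erase _ _ (Finset.mem_erase.mpr ⟨hjk.symm, Finset.mem_univ k⟩), hkk,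
        pow_zero, one_mul, Finset.erase_right_comm, ← Finset.prod_mul_distrib]
      simp only [e₄, hjk, if_false, if_true, pow_zero, one_mul]
      refine Finset.prod_congr rfl fun i hi => ?_
      rw [if_neg, if_neg, pow_add]
      all_goals rintro rfl; simp at hi
    rw [hex, h₃, h₄]
    refine htp.free.regularMod _ _ _ _ k j ?_
    simp [hq'kj, hq'jk, hq'jj, e₃, e₄, hjk, hb]
  obtain ⟨hxj', hregq⟩ := regularMod_of_rank_two h1 hzk hjj' hjw hMp hp0 (ht0 k) (ht0 j)
    (hxprod0 _ _) (hxprod0 _ _) (hmem k) (hinv k) (hmem j) (hinv j) hA hD hD' hE hM hM' hp hreg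
  have hxk : x k ∈ t.laurent := by
    have hxj : x j ∈ t.laurent := by
      have : x j = (s.mutate k).exchange j * (t.cluster j)⁻¹ := by
        rw [← hjw, mul_assoc, mul_inv_cancel₀ (ht0 j), mul_one]
      rw [this]
      exact Subring.mul_mem _ hp (hinv j)
    have : x k = (D + x j ^ q k j * E) * (t.cluster k)⁻¹ := by
      rw [← hzk, mul_comm, ← mul_assoc, inv_mul_cancel₀ (ht0 k), one_mul]
    rw [this]
    exact Subring.mul_mem _ (Subring.add_mem _ hD (Subring.mul_mem _ (Subring.pow_mem _ hxj _) hE))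
      (hinv k)
  have hQ : s.exchange j / x j * (t.cluster k * x k) ∈ t.laurent :=
    Subring.mul_mem _ hxj' (Subring.mul_mem _ (hmem k) hxk)
  have hxj0 := hx0 j
  have hxk0 := hx0 k
  rintro f ⟨hfk, hfj⟩
  refine hregq.mem hp0 hp hQ (s.laurent_mutate_le k ?_ ?_ ?_ hfk)
    (s.laurent_mutate_le j ?_ ?_ ?_ hfj)
  · intro i hik
    by_cases hij : i = j
    · subst hij
      have hi0 := ht0 i
      refine ⟨le_awaySubring _ hp ?_, 1, ?_⟩
      · have : x i = (s.mutate k).exchange i * (t.cluster i)⁻¹ := by rw [← hjw]; field_simp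
        change x i ∈ _
        rw [this]
        exact Subring.mul_mem _ hp (hinv i)
      · have : (s.mutate k).exchange i ^ 1 * (x i)⁻¹ = t.cluster i := by rw [← hjw]; field_simp
        rw [this]
        exact hmem i
    · exact ⟨le_awaySubring _ hp (hxmem i hij hik), le_awaySubring _ hp (hxinv i hij hik)⟩
  · rw [← hx, ← htk]; exact le_awaySubring _ hp (hmem k)
  · rw [← hx, ← htk]; exact le_awaySubring _ hp (hinv k)
  · intro i hij
    by_cases hik : i = k
    · subst hik
      refine ⟨le_awaySubring _ hQ hxk, 1, ?_⟩
      have : (s.exchange j / x j * (t.cluster i * x i)) ^ 1 * (x i)⁻¹ =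
          s.exchange j / x j * t.cluster i := by field_simp
      rw [this]
      exact Subring.mul_mem _ hxj' (hmem i)
    · exact ⟨le_awaySubring _ hQ (hxmem i hij hik), le_awaySubring _ hQ (hxinv i hij hik)⟩
  · exact le_awaySubring _ hQ hxj'
  · refine ⟨1, ?_⟩
    have : (s.exchange j / x j * (t.cluster k * x k)) ^ 1 * (s.exchange j / x j)⁻¹ =
        t.cluster k * x k := by field_simp
    rw [← hx, this]
    exact Subring.mul_mem _ (hmem k) hxk

/-- The upper bound of a seed: the elements that are Laurent polynomials in its cluster and in each
of the adjacent clusters. -/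
noncomputable def Seed.upperBound (s : Seed W) : Subring (FunField W) :=
  s.laurent ⊓ ⨅ j, (s.mutate j).laurent

/-- For nonsingular exchange matrices, mutation does not shrink the upper bound; as it is an
involution on seeds, it does not change it at all. -/
lemma Seed.upperBound_le_mutate {s : Seed W} (hs : s.IsProper) (hn : IsNonsingular s.arrows)
    (k : W) : s.upperBound ≤ (s.mutate k).upperBound := by
  have hk : s.upperBound ≤ (s.mutate k).laurent := inf_le_right.trans (iInf_le _ k)
  refine le_inf hk (le_iInf fun j => ?_)
  by_cases hjk : j = k
  · subst hjk
    rw [hs.mutate_mutate]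
    exact inf_le_left
  refine (le_inf hk (inf_le_right.trans (iInf_le _ j))).trans ?_
  by_cases h1 : s.arrows k j = 0
  · by_cases h2 : s.arrows j k = 0
    · exact Seed.inf_laurent_le_of_arrows_eq_zero hs hn hjk h1 h2
    -- Arrows `j → k` become arrows `k → j` when the quiver is reversed, with the same clusters.
    · have := Seed.inf_laurent_le_of_arrows_ne_zero hs.op hjk (show s.op.arrows k j ≠ 0 from h2)
      rwa [Seed.op_mutate, Seed.op_mutate, Seed.op_mutate] at this
  · exact Seed.inf_laurent_le_of_arrows_ne_zero hs hjk h1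

/-- By the exchange relation, a cluster variable is a Laurent polynomial in each of the adjacent
clusters. -/
lemma Seed.cluster_mem_upperBound {s : Seed W} (hs : s.IsProper) (i : W) :
    s.cluster i ∈ s.upperBound := by
  refine Subring.mem_inf.mpr ⟨self_mem_laurentSubring s.cluster i, Subring.mem_iInf.mpr fun j => ?_⟩
  by_cases hij : i = j
  · subst hij
    have h1 : s.cluster i = s.exchange i * ((s.mutate i).cluster i)⁻¹ := by
      rw [s.mutate_cluster_self]
      have := hs.exchange_ne_zero i
      have := hs.free.ne_zero i
      field_simp
    rw [h1, ← hs.exchange_mutate]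
    refine Subring.mul_mem _ (Subring.add_mem _ ?_ ?_) (inv_mem_laurentSubring _ i)
    all_goals exact prod_pow_mem fun l _ _ => self_mem_laurentSubring _ l
  · rw [← s.mutate_cluster_of_ne hij]
    exact self_mem_laurentSubring _ i

/-- The seed `t` is obtained from `s` by finitely many mutations. -/
def Seed.Reaches (s t : Seed W) : Prop := Relation.ReflTransGen (fun a b => ∃ j, b = a.mutate j) s t

lemma Seed.Reaches.isProper {s t : Seed W} (h : s.Reaches t) (hs : s.IsProper) : t.IsProper := by
  induction h with
  | refl => exact hs
  | tail _ h ih => obtain ⟨j, rfl⟩ := h; exact ih.mutate j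

lemma Seed.Reaches.isNonsingular {s t : Seed W} (h : s.Reaches t) (hs : s.IsProper)
    (hn : IsNonsingular s.arrows) : IsNonsingular t.arrows := by
  induction h with
  | refl => exact hn
  | tail h' h ih =>
    obtain ⟨j, rfl⟩ := h
    exact ih.mutateArrows (Seed.Reaches.isProper h' hs).twoAcyclic j

/-- The Laurent phenomenon for nonsingular exchange matrices. -/
theorem Seed.Reaches.cluster_mem_laurent {s t : Seed W} (h : s.Reaches t) (hs : s.IsProper)
    (hn : IsNonsingular s.arrows) (i : W) : t.cluster i ∈ s.laurent := by
  have key : t.upperBound ≤ s.upperBound := by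
    induction h with
    | refl => exact le_rfl
    | @tail a b h' h ih =>
      obtain ⟨j, rfl⟩ := h
      have ha := Seed.Reaches.isProper h' hs
      have han := Seed.Reaches.isNonsingular h' hs hn
      refine le_trans ?_ ih
      have := Seed.upperBound_le_mutate (ha.mutate j) (han.mutateArrows ha.twoAcyclic j) j
      rwa [ha.mutate_mutate] at this
  exact (key.trans inf_le_left) (Seed.cluster_mem_upperBound (h.isProper hs) i)

end UpperBound

/-! ### The Laurent phenomenon for arbitrary quivers -/

section Framing

lemma Laurent.eval_algebraMap_var {V : Type u} [Fintype V]
    (h0 : ∀ v : V, algebraMap (Laurent V) (FunField V) (Laurent.var v : (Laurent V)ˣ) ≠ 0) :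
    Laurent.eval (fun v => Units.mk0 _ (h0 v)) = algebraMap (Laurent V) (FunField V) :=
  Laurent.hom_ext fun v => by rw [Laurent.eval_var]; rfl

/-- The variables of the field of rational functions are free. -/
lemma isFree_var (V : Type u) [Fintype V] :
    IsFree fun v : V => algebraMap (Laurent V) (FunField V) (Laurent.var v : (Laurent V)ˣ) := by
  have hinj : Injective (algebraMap (Laurent V) (FunField V)) := IsFractionRing.injective _ _
  have h0 : ∀ v : V, algebraMap (Laurent V) (FunField V) (Laurent.var v : (Laurent V)ˣ) ≠ 0 :=
    fun v => by
      rw [map_ne_zero_iff _ hinj]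
      exact (Laurent.var v).ne_zero
  refine ⟨h0, ?_⟩
  rw [Laurent.eval_algebraMap_var]
  exact hinj

variable {V : Type u}

/-- The framing of a quiver: every vertex `v`, now called `inl v`, receives one arrow from a new
vertex `inr v`. -/
def framedArrows [DecidableEq V] (q : V → V → ℕ) : V ⊕ V → V ⊕ V → ℕ
  | .inl i, .inl j => q i j
  | .inr i, .inl j => if i = j then 1 else 0
  | _, .inr _ => 0

lemma IsTwoAcyclic.framedArrows [DecidableEq V] {q : V → V → ℕ} (hq : IsTwoAcyclic q) :
    IsTwoAcyclic (framedArrows q) := by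
  rintro (i | i) (j | j)
  · exact hq i j
  · exact Or.inl rfl
  · exact Or.inr rfl
  · exact Or.inl rfl

lemma isNonsingular_framedArrows [Fintype V] [DecidableEq V] (q : V → V → ℕ) :
    IsNonsingular (framedArrows q) := by
  intro c hc
  have h1 : ∀ i, c (.inl i) = 0 := fun i => by
    simpa [Fintype.sum_sum_type, netArrows, framedArrows] using hc (.inr i)
  have h2 : ∀ i, c (.inr i) = 0 := fun i => by
    simpa [Fintype.sum_sum_type, netArrows, framedArrows, h1] using hc (.inl i)
  ext (i | i)
  · exact h1 i
  · exact h2 i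

lemma mutateArrows_inl [DecidableEq V] {q : V → V → ℕ} {Q : V ⊕ V → V ⊕ V → ℕ}
    (h : ∀ i j, Q (.inl i) (.inl j) = q i j) (k i j : V) :
    mutateArrows Q (.inl k) (.inl i) (.inl j) = mutateArrows q k i j := by
  simp [mutateArrows, completedArrows, h]

variable [Fintype V] [DecidableEq V]

/-- The seed with the variables as cluster and the framed quiver. -/
noncomputable def framedSeed (q : V → V → ℕ) : Seed (V ⊕ V) where
  arrows := framedArrows q
  cluster := fun v => algebraMap (Laurent (V ⊕ V)) (FunField (V ⊕ V)) (Laurent.var v).val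

/-- The Laurent phenomenon. The exchange matrix of the framed quiver is nonsingular, and setting the
new variables equal to `1` turns its cluster variables into those of the given quiver. -/
theorem Seed.Reaches.cluster_mem_laurent_of_isProper {s t : Seed V} (h : s.Reaches t)
    (hs : s.IsProper) (i : V) : t.cluster i ∈ s.laurent := by
  have hT₀ : (framedSeed s.arrows).IsProper := ⟨hs.twoAcyclic.framedArrows, isFree_var _⟩
  have hinj : Injective (algebraMap (Laurent (V ⊕ V)) (FunField (V ⊕ V))) :=
    IsFractionRing.injective _ _
  let φ : Laurent (V ⊕ V) →+* FunField V :=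
    Laurent.eval (Sum.elim (fun i => Units.mk0 (s.cluster i) (hs.free.ne_zero i)) 1)
  have hφ : ∀ f, φ f ∈ s.laurent := by
    have h1 := range_eval_eq_laurentSubring
      (Sum.elim (fun i => Units.mk0 (s.cluster i) (hs.free.ne_zero i)) (1 : V → (FunField V)ˣ))
    have h2 : φ.range ≤ s.laurent := by
      rw [h1]
      refine laurentSubring_le ?_
      rintro (i | i)
      · exact ⟨self_mem_laurentSubring s.cluster i, inv_mem_laurentSubring s.cluster i⟩
      · simp
    exact fun f => h2 ⟨f, rfl⟩
  suffices key : ∃ T : Seed (V ⊕ V), (framedSeed s.arrows).Reaches T ∧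
      (∀ i j, T.arrows (.inl i) (.inl j) = t.arrows i j) ∧
      ∀ v, ∃ f, algebraMap _ _ f = T.cluster v ∧ φ f = Sum.elim t.cluster 1 v by
    obtain ⟨T, -, -, hT⟩ := key
    obtain ⟨f, -, hf⟩ := hT (.inl i)
    rw [Sum.elim_inl] at hf
    rw [← hf]
    exact hφ f
  induction h with
  | refl =>
    refine ⟨framedSeed s.arrows, .refl, fun i j => rfl, fun v => ⟨Laurent.var v, rfl, ?_⟩⟩
    rw [Laurent.eval_var]
    rcases v with v | v
    · rfl
    · rfl
  | @tail t _ hst hstep ih =>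
    obtain ⟨j, rfl⟩ := hstep
    obtain ⟨T, hreach, harr, hF⟩ := ih
    choose F hF hφF using hF
    have htp : t.IsProper := Seed.Reaches.isProper hst hs
    have hTp := hreach.isProper hT₀
    have hreach' : (framedSeed s.arrows).Reaches (T.mutate (.inl j)) :=
      hreach.tail ⟨.inl j, rfl⟩
    refine ⟨T.mutate (.inl j), hreach', mutateArrows_inl harr j, fun v => ?_⟩
    by_cases hv : v = .inl j
    · subst hv
      have hmem := hreach'.cluster_mem_laurent hT₀ (isNonsingular_framedArrows _) (.inl j)
      rw [Seed.laurent, mem_laurentSubring_iff hT₀.free.ne_zero] at hmem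
      obtain ⟨f, hf⟩ := hmem
      have hev : Laurent.eval (fun v => Units.mk0 _ (hT₀.free.ne_zero v)) =
          algebraMap (Laurent (V ⊕ V)) (FunField (V ⊕ V)) := Laurent.eval_algebraMap_var _
      rw [hev] at hf
      refine ⟨f, hf, ?_⟩
      -- The exchange relation is one between Laurent polynomials, so that `φ` applies to it.
      have hrel : f * F (.inl j) =
          ∏ i, F i ^ T.arrows i (.inl j) + ∏ i, F i ^ T.arrows (.inl j) i := by
        apply hinj
        rw [map_mul, hf, hF, Seed.mutate_cluster_self, div_mul_cancel₀ _ (hTp.free.ne_zero _)]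
        simp only [map_add, map_prod, map_pow, hF]
        rfl
      have := congrArg φ hrel
      simp only [map_mul, map_add, map_prod, map_pow, hφF, Fintype.prod_sum_type, Sum.elim_inl,
        Sum.elim_inr, Pi.one_apply, one_pow, Finset.prod_const_one, mul_one, harr] at this
      rw [Sum.elim_inl, Seed.mutate_cluster_self, eq_div_iff (htp.free.ne_zero j)]
      exact this
    · refine ⟨F v, ?_, ?_⟩
      · rw [Seed.mutate_cluster_of_ne _ hv, hF]
      · rw [hφF]
        rcases v with v | v
        · rw [Sum.elim_inl, Sum.elim_inl, Seed.mutate_cluster_of_ne]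
          rintro rfl
          exact hv rfl
        · rfl

end Framing

section Quiver

lemma initialSeed_isProper {V : Type u} [Fintype V] [Quiver.{w} V]
    (hq : IsTwoAcyclic (arrowCount V)) : (initialSeed V).IsProper :=
  ⟨hq, isFree_var V⟩

variable {V : Type u} [Fintype V] [DecidableEq V] [Quiver.{w} V]

lemma IsSeed.reaches {t : Seed V} (ht : IsSeed V t) : (initialSeed V).Reaches t := by
  induction ht with
  | initial => exact .refl
  | mutate s j _ ih => exact ih.tail ⟨j, rfl⟩

/-- Every element of the cluster algebra is a Laurent polynomial in each cluster adjacent to the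
initial one. -/
theorem clusterAlgebra_le_laurent_mutate (hq : IsTwoAcyclic (arrowCount V)) (v : V) :
    clusterAlgebra V ≤ ((initialSeed V).mutate v).laurent := by
  refine Subring.closure_le.mpr ?_
  rintro _ ⟨t, ht, i, rfl⟩
  have hp := initialSeed_isProper hq
  have hback : ((initialSeed V).mutate v).Reaches (initialSeed V) :=
    .single ⟨v, (hp.mutate_mutate v).symm⟩
  exact Seed.Reaches.cluster_mem_laurent_of_isProper (Relation.ReflTransGen.trans hback ht.reaches)
    (hp.mutate v) i

end Quiver

/-! ### Exponents of Laurent polynomials -/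

section Support

variable {V : Type u}

/-- All exponents of the Laurent polynomial lie in the given set. -/
def Laurent.SupportedIn (f : Laurent V) (T : Set (V →₀ ℤ)) : Prop :=
  ∀ e ∈ f.coeff.support, e ∈ T

lemma Laurent.supportedIn_zero (T : Set (V →₀ ℤ)) : (0 : Laurent V).SupportedIn T := by
  intro e he
  simp at he

lemma Laurent.supportedIn_single {e : V →₀ ℤ} {T : Set (V →₀ ℤ)} (he : e ∈ T) (c : ℤ) :
    Laurent.SupportedIn (AddMonoidAlgebra.single e c) T := by
  classical
  intro e' he'
  rw [AddMonoidAlgebra.coeff_single] at he'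
  rwa [Finset.mem_singleton.mp (Finsupp.support_single_subset he')]

lemma Laurent.SupportedIn.add {f g : Laurent V} {T : Set (V →₀ ℤ)} (hf : f.SupportedIn T)
    (hg : g.SupportedIn T) : (f + g).SupportedIn T := by
  classical
  intro e he
  rw [AddMonoidAlgebra.coeff_add] at he
  exact (Finset.mem_union.mp (Finsupp.support_add he)).elim (hf e) (hg e)

lemma Laurent.SupportedIn.mul {f g : Laurent V} {T T' T'' : Set (V →₀ ℤ)} (hf : f.SupportedIn T)
    (hg : g.SupportedIn T') (h : ∀ e ∈ T, ∀ e' ∈ T', e + e' ∈ T'') : (f * g).SupportedIn T'' := by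
  classical
  intro e he
  obtain ⟨a, ha, b, hb, rfl⟩ := Finset.mem_add.mp (AddMonoidAlgebra.support_coeff_mul_subset f g he)
  exact h a (hf a ha) b (hg b hb)

lemma Laurent.SupportedIn.induction {T : Set (V →₀ ℤ)} {motive : Laurent V → Prop} {f : Laurent V}
    (hf : f.SupportedIn T) (zero : motive 0) (add : ∀ f g, motive f → motive g → motive (f + g))
    (single : ∀ e ∈ T, ∀ c, motive (AddMonoidAlgebra.single e c)) : motive f := by
  rw [← AddMonoidAlgebra.sum_coeff_single f]
  exact Finset.sum_induction _ motive add zero fun e he => single e (hf e he) _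

/-- Splitting a Laurent polynomial according to its exponents. -/
lemma Laurent.exists_eq_add (T : Set (V →₀ ℤ)) (f : Laurent V) :
    ∃ g h : Laurent V, f = g + h ∧ g.SupportedIn T ∧ h.SupportedIn Tᶜ := by
  induction f using AddMonoidAlgebra.induction_linear with
  | zero => exact ⟨0, 0, by simp, supportedIn_zero _, supportedIn_zero _⟩
  | add f f' hf hf' =>
    obtain ⟨g, h, rfl, hg, hh⟩ := hf
    obtain ⟨g', h', rfl, hg', hh'⟩ := hf'
    exact ⟨g + g', h + h', by ring, hg.add hg', hh.add hh'⟩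
  | single e c =>
    by_cases he : e ∈ T
    · exact ⟨_, 0, (add_zero _).symm, supportedIn_single he c, supportedIn_zero _⟩
    · exact ⟨0, _, (zero_add _).symm, supportedIn_zero _, supportedIn_single he c⟩

lemma Laurent.eq_zero_of_supportedIn {f : Laurent V} {T T' : Set (V →₀ ℤ)} (h : f.SupportedIn T)
    (h' : f.SupportedIn T') (hT : ∀ e ∈ T, e ∉ T') : f = 0 := by
  rw [← AddMonoidAlgebra.coeff_eq_zero, ← Finsupp.support_eq_empty,
    Finset.eq_empty_iff_forall_notMem]
  exact fun e he => hT e (h e he) (h' e he)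

/-- If `p` does not involve `x_v` and `p * f` is polynomial in `x_v`, then so is `f`. -/
lemma Laurent.IsPolynomialIn.of_mul {p f : Laurent V} {v : V} (hp0 : p ≠ 0)
    (hp : p.SupportedIn {e | e v = 0}) (h : (p * f).IsPolynomialIn v) : f.IsPolynomialIn v := by
  obtain ⟨g, n, rfl, hg, hn⟩ := exists_eq_add {e : V →₀ ℤ | 0 ≤ e v} f
  have h1 : (p * n).SupportedIn {e | 0 ≤ e v} := by
    have h2 : (p * g).SupportedIn {e | 0 ≤ e v} := hp.mul hg fun e he e' he' => by
      simpa [show e v = 0 from he] using he'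
    have h3 : (-1 * (p * g)).SupportedIn {e | 0 ≤ e v} :=
      (show Laurent.SupportedIn (-1 : Laurent V) {e | 0 ≤ e v} by
        rw [AddMonoidAlgebra.one_def, ← AddMonoidAlgebra.single_neg]
        exact supportedIn_single (by simp) _).mul h2
        fun e he e' he' => by simpa using add_nonneg he he'
    have : p * n = p * (g + n) + -1 * (p * g) := by ring
    rw [this]
    exact SupportedIn.add h h3
  have h2 : (p * n).SupportedIn {e | e v < 0} := hp.mul hn fun e he e' he' => by
    simpa [show e v = 0 from he] using he'
  have h3 : p * n = 0 := eq_zero_of_supportedIn h2 h1 fun e he => not_le.mpr (show e v < 0 from he)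
  rw [(mul_eq_zero.mp h3).resolve_left hp0, add_zero]
  exact hg

end Support

/-! ### Specialisation -/

section Specialise

variable {V : Type u} [Fintype V] [DecidableEq V] (S : Finset V) (a : S → ℤˣ)

/-- The sign that the specialisation gives to the monomial with exponent `e`. -/
def specialisationSign (e : V →₀ ℤ) : ℤˣ := ∏ j : S, a j ^ e j

lemma specialise_single (e : V →₀ ℤ) (c : ℤ) :
    specialise S a (AddMonoidAlgebra.single e c) =
      AddMonoidAlgebra.single (e.subtypeDomain (· ∉ S)) (c * specialisationSign S a e) := by
  set r : V → (Laurent {v : V // v ∉ S})ˣ := fun v =>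
    if h : v ∈ S then Units.map (Int.castRingHom (Laurent {v : V // v ∉ S})) (a ⟨v, h⟩)
    else Laurent.var ⟨v, h⟩ with hr
  have h1 : ∏ v : {v // v ∈ S}, r v ^ e v =
      Units.map (Int.castRingHom (Laurent {v : V // v ∉ S})) (specialisationSign S a e) := by
    rw [specialisationSign, map_prod]
    refine Finset.prod_congr rfl fun v _ => ?_
    rw [hr, map_zpow]
    simp only
    rw [dif_pos v.2]
  have h2 : ∏ v : {v // v ∉ S}, r v ^ e v =
      monomialUnit Laurent.var (e.subtypeDomain (· ∉ S)) := by
    refine Finset.prod_congr rfl fun v _ => ?_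
    rw [hr]
    simp only
    rw [dif_neg v.2]
    rfl
  have hsplit : ∏ v, r v ^ e v = (∏ v : {v // v ∈ S}, r v ^ e v) *
      ∏ v : {v // v ∉ S}, r v ^ e v := by
    rw [← Fintype.prod_subtype_mul_prod_subtype (fun v => v ∈ S)]
    congr!
  rw [specialise, Laurent.eval_single, ← hr, monomialUnit, hsplit, h1, h2, Units.val_mul,
    ← Laurent.single_eq_monomialUnit]
  have h3 : (Units.map (Int.castRingHom (Laurent {v : V // v ∉ S})).toMonoidHom
      (specialisationSign S a e)).val = ((specialisationSign S a e : ℤ) : Laurent _) := rfl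
  rw [← mul_assoc]
  erw [h3]
  rw [← Int.cast_mul, AddMonoidAlgebra.intCast_def, AddMonoidAlgebra.single_mul_single]
  simp

lemma specialise_supportedIn {f : Laurent V} {v : {v : V // v ∉ S}} {T : Set ℤ}
    (hf : f.SupportedIn {e | e v ∈ T}) : (specialise S a f).SupportedIn {e | e v ∈ T} := by
  refine hf.induction (motive := fun f => (specialise S a f).SupportedIn _) ?_ ?_ ?_
  · rw [map_zero]; exact Laurent.supportedIn_zero _
  · intro f g hf hg
    rw [map_add]
    exact hf.add hg
  · intro e he c
    rw [specialise_single]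
    exact Laurent.supportedIn_single (T := {e | e v ∈ T}) he _

end Specialise

/-! ### The polyamorous variables -/

section Criterion

variable {V : Type u} [Fintype V]

/-- The exponent vector of the product of the variables `x_i` over the arrows `i → v`. -/
noncomputable def inExponent (q : V → V → ℕ) (v : V) : V →₀ ℤ :=
  Finsupp.equivFunOnFinite.symm fun i => (q i v : ℤ)

/-- The numerator `∏_{i → v} x_i + ∏_{v → i} x_i` of the exchange relation at `v`. -/
noncomputable def exchangePoly (q : V → V → ℕ) (v : V) : Laurent V :=
  AddMonoidAlgebra.single (inExponent q v) 1 +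
    AddMonoidAlgebra.single (inExponent (fun i j => q j i) v) 1

lemma exchangePoly_supportedIn {q : V → V → ℕ} (hq : IsTwoAcyclic q) (v : V) :
    (exchangePoly q v).SupportedIn {e | e v = 0} := by
  have h : ∀ q' : V → V → ℕ, q' v v = 0 → inExponent q' v v = 0 := fun q' h => by
    simp [inExponent, h]
  exact (Laurent.supportedIn_single (T := {e | e v = 0}) (h q (hq.self v)) 1).add
    (Laurent.supportedIn_single (h _ (hq.self v)) 1)

lemma exchangePoly_eq (q : V → V → ℕ) (v : V) :
    exchangePoly q v = (monomialUnit Laurent.var fun i => (q i v : ℤ) : (Laurent V)ˣ) +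
      (monomialUnit Laurent.var fun i => (q v i : ℤ)).val := by
  rw [exchangePoly, Laurent.single_eq_monomialUnit, Laurent.single_eq_monomialUnit]
  rfl

lemma exchangePoly_ne_zero (q : V → V → ℕ) (v : V) : exchangePoly q v ≠ 0 := by
  rw [exchangePoly_eq]
  exact add_monomialUnit_ne_zero _ _

lemma algebraMap_exchangePoly [Quiver.{w} V] (v : V) :
    algebraMap _ (FunField V) (exchangePoly (arrowCount V) v) = (initialSeed V).exchange v := by
  have h := eval_add_monomialUnit
    (fun i => Units.mk0 _ ((isFree_var V).ne_zero i)) (fun i => arrowCount V i v)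
    (fun i => arrowCount V v i)
  rw [Laurent.eval_algebraMap_var] at h
  rw [exchangePoly_eq, h]
  rfl

variable (S : Finset V) (a : S → ℤˣ)

/-- The sign `(-1) ^ t` of a class `t` modulo `2`. -/
def zmodSign (t : ZMod 2) : ℤˣ := (-1) ^ t.val

lemma zmodSign_add : ∀ x y : ZMod 2, zmodSign (x + y) = zmodSign x * zmodSign y := by decide

lemma zmodSign_eq_neg_one_iff : ∀ x : ZMod 2, zmodSign x = -1 ↔ x = 1 := by decide

lemma zmodSign_natCast_mul (n : ℕ) (t : ZMod 2) : zmodSign (n * t) = zmodSign t ^ n := by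
  induction n with
  | zero => simp [zmodSign]
  | succ n ih => rw [Nat.cast_succ, add_mul, one_mul, zmodSign_add, ih, pow_succ]

lemma zmodSign_sum {ι : Type*} (T : Finset ι) (f : ι → ZMod 2) :
    zmodSign (∑ i ∈ T, f i) = ∏ i ∈ T, zmodSign (f i) := by
  classical
  induction T using Finset.induction_on with
  | empty => simp [zmodSign]
  | insert i T hi ih => rw [Finset.sum_insert hi, Finset.prod_insert hi, zmodSign_add, ih]

lemma specialisationSign_inExponent (s : S → ZMod 2) (hs : ∀ j, a j = (-1) ^ (s j).val)
    (q : V → V → ℕ) (v : V) :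
    specialisationSign S a (inExponent q v) = zmodSign (∑ j : S, (q j v : ZMod 2) * s j) := by
  rw [specialisationSign, zmodSign_sum]
  refine Finset.prod_congr rfl fun j _ => ?_
  rw [zmodSign_natCast_mul, hs, zmodSign]
  simp [inExponent]

lemma units_eq_neg_iff : ∀ x y : ℤˣ, x = -y ↔ x * y = -1 := by decide

lemma specialisationSign_eq_neg_iff (s : S → ZMod 2) (hs : ∀ j, a j = (-1) ^ (s j).val)
    (q : V → V → ℕ) (v : V) :
    specialisationSign S a (inExponent q v) =
        -specialisationSign S a (inExponent (fun i j => q j i) v) ↔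
      ∑ j : S, (((q v j : ℤ) - q j v : ℤ) : ZMod 2) * s j = 1 := by
  rw [units_eq_neg_iff, specialisationSign_inExponent S a s hs,
    specialisationSign_inExponent S a s hs, ← zmodSign_add, zmodSign_eq_neg_one_iff,
    ← Finset.sum_add_distrib]
  refine Eq.congr_left (Finset.sum_congr rfl fun j _ => ?_)
  push_cast
  rw [CharTwo.sub_eq_add]
  ring

variable [DecidableEq V]

lemma specialise_exchangePoly_eq_zero_iff {q : V → V → ℕ} (hq : IsTwoAcyclic q) (v : V) :
    specialise S a (exchangePoly q v) = 0 ↔ (∀ i ∉ S, q i v = 0 ∧ q v i = 0) ∧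
      specialisationSign S a (inExponent q v) =
        -specialisationSign S a (inExponent (fun i j => q j i) v) := by
  rw [exchangePoly, map_add, specialise_single, specialise_single, one_mul, one_mul]
  set c₁ := specialisationSign S a (inExponent q v)
  set c₂ := specialisationSign S a (inExponent (fun i j => q j i) v)
  constructor
  · intro h
    have h1 := congrArg (fun f : Laurent {v : V // v ∉ S} =>
      f.coeff ((inExponent q v).subtypeDomain (· ∉ S))) h
    simp only [AddMonoidAlgebra.coeff_add, AddMonoidAlgebra.coeff_single, Finsupp.add_apply,
      Finsupp.single_eq_same, AddMonoidAlgebra.coeff_zero, Finsupp.zero_apply] at h1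
    by_cases he : (inExponent (fun i j => q j i) v).subtypeDomain (· ∉ S) =
        (inExponent q v).subtypeDomain (· ∉ S)
    · rw [he, Finsupp.single_eq_same] at h1
      refine ⟨fun i hi => ?_, Units.ext (eq_neg_of_add_eq_zero_left h1)⟩
      have h2 : (q v i : ℤ) = q i v := DFunLike.congr_fun he ⟨i, hi⟩
      have := hq i v
      omega
    · rw [Finsupp.single_eq_of_ne (Ne.symm he), add_zero] at h1
      exact absurd h1 c₁.ne_zero
  · rintro ⟨h1, h2⟩
    have h3 : ∀ q' : V → V → ℕ, (∀ i ∉ S, q' i v = 0) →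
        (inExponent q' v).subtypeDomain (· ∉ S) = 0 := fun q' h => by
      ext i
      simpa [inExponent] using h i i.2
    rw [h3 _ fun i hi => (h1 i hi).1, h3 _ fun i hi => (h1 i hi).2, h2,
      ← AddMonoidAlgebra.single_add]
    simp

end Criterion

section Polyamorous

variable {V : Type u} [Fintype V] [DecidableEq V]

/-- The substitution `x_v ↦ p / x_v` sends the monomial `x^e` to `p ^ e_v` times a monomial in which
`x_v` has exponent `-e_v`. -/
lemma monomialUnit_update {R : Type*} [CommRing R] (x : V → Rˣ) (p : Rˣ) (v : V) (e : V →₀ ℤ) :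
    monomialUnit (Function.update x v (p * (x v)⁻¹)) e =
      p ^ e v * monomialUnit x (e.update v (-e v)) := by
  rw [monomialUnit, monomialUnit, ← Finset.mul_prod_erase _ _ (Finset.mem_univ v),
    ← Finset.mul_prod_erase _ (fun i => x i ^ (e.update v (-e v)) i) (Finset.mem_univ v),
    ← mul_assoc]
  refine congrArg₂ (· * ·) ?_ (Finset.prod_congr rfl fun i hi => ?_)
  · simp [mul_zpow]
  · rw [Function.update_of_ne (Finset.ne_of_mem_erase hi)]
    simp [Finsupp.update, Finset.ne_of_mem_erase hi]

/-- If a Laurent polynomial `f` becomes one also after the substitution `x_v ↦ p / x_v`, it is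
a multiple of `p` up to terms that are polynomial in `x_v`. -/
lemma exists_dvd_isPolynomialIn_of_mem_laurent {K : Type*} [Field K] {ι : Laurent V →+* K}
    (hι : Injective ι) {p : Laurent V} (hp0 : p ≠ 0) {v : V} (hp : p.SupportedIn {e | e v = 0})
    {f : Laurent V} (hf : ι f ∈ laurentSubring (Function.update
      (fun i => ι (Laurent.var i : (Laurent V)ˣ)) v (ι p / ι (Laurent.var v : (Laurent V)ˣ)))) :
    ∃ g h : Laurent V, f = p * g + h ∧ h.IsPolynomialIn v := by
  let x : V → Kˣ := fun i => Units.map (ι : Laurent V →* K) (Laurent.var i)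
  have hιp0 : ι p ≠ 0 := (map_ne_zero_iff ι hι).mpr hp0
  let P : Kˣ := Units.mk0 (ι p) hιp0
  have hx : (fun i => ((Function.update x v (P * (x v)⁻¹) i : Kˣ) : K)) = Function.update
      (fun i => ι (Laurent.var i : (Laurent V)ˣ)) v (ι p / ι (Laurent.var v : (Laurent V)ˣ)) := by
    ext i
    by_cases hi : i = v
    · subst hi
      rw [Function.update_self, Function.update_self, Units.val_mul, Units.val_inv_eq_inv_val,
        div_eq_mul_inv]
      rfl
    · rw [Function.update_of_ne hi, Function.update_of_ne hi]
      rfl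
  rw [← hx, ← range_eval_eq_laurentSubring] at hf
  obtain ⟨g, hg⟩ := hf
  set θ := Laurent.eval (Function.update x v (P * (x v)⁻¹)) with hθ
  have hsingle : ∀ (e : V →₀ ℤ) (c : ℤ), θ (AddMonoidAlgebra.single e c) =
      ι p ^ e v * ι (AddMonoidAlgebra.single (e.update v (-e v)) c) := by
    intro e c
    have hιe : Laurent.eval x = ι := Laurent.hom_ext fun i => by rw [Laurent.eval_var]; rfl
    rw [hθ, Laurent.eval_single, monomialUnit_update, ← hιe, Laurent.eval_single, Units.val_mul,
      Units.val_zpow_eq_zpow_val, hιe, show (P : K) = ι p from rfl]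
    ring
  -- The terms of positive degree in the new variable give the multiple of `p`. Those of degree at
  -- most `0` become polynomial in `x_v` once a power of `p` has cleared the denominators.
  obtain ⟨g₁, g₂, rfl, hg₁, hg₂⟩ := Laurent.exists_eq_add {e : V →₀ ℤ | 1 ≤ e v} g
  obtain ⟨f₁, hf₁⟩ : ∃ f₁, ι (p * f₁) = θ g₁ := by
    refine hg₁.induction (motive := fun g => ∃ f₁, ι (p * f₁) = θ g) ⟨0, by simp⟩ ?_ ?_
    · rintro g g' ⟨f, hf⟩ ⟨f', hf'⟩
      exact ⟨f + f', by rw [mul_add, map_add, hf, hf', map_add]⟩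
    · intro e he c
      obtain ⟨n, hn⟩ : ∃ n : ℕ, e v = n + 1 := ⟨(e v - 1).toNat, by
        have : 1 ≤ e v := he
        omega⟩
      refine ⟨p ^ n * AddMonoidAlgebra.single (e.update v (-e v)) c, ?_⟩
      rw [hsingle, ← mul_assoc, ← pow_succ', map_mul, map_pow, hn]
      norm_cast
  obtain ⟨N, f₂, hf₂, hf₂'⟩ : ∃ (N : ℕ) (f₂ : Laurent V), f₂.SupportedIn {e | 0 ≤ e v} ∧
      ι f₂ = ι p ^ N * θ g₂ := by
    refine hg₂.induction (motive := fun g => ∃ (N : ℕ) (f₂ : Laurent V),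
      f₂.SupportedIn {e | 0 ≤ e v} ∧ ι f₂ = ι p ^ N * θ g)
      ⟨0, 0, Laurent.supportedIn_zero _, by simp⟩ ?_ ?_
    · rintro g g' ⟨N, f, hf, hfg⟩ ⟨N', f', hf', hfg'⟩
      have hpN : ∀ (n : ℕ) {f : Laurent V}, f.SupportedIn {e | 0 ≤ e v} →
          (p ^ n * f).SupportedIn {e | 0 ≤ e v} := by
        intro n f hf
        induction n with
        | zero => simpa using hf
        | succ n ih =>
          rw [pow_succ', mul_assoc]
          exact hp.mul ih fun e he e' he' => by simpa [show e v = 0 from he] using he'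
      refine ⟨N + N', p ^ N' * f + p ^ N * f', (hpN N' hf).add (hpN N hf'), ?_⟩
      rw [map_add, map_mul, map_mul, hfg, hfg', map_pow, map_pow, map_add]
      ring
    · intro e he c
      have he' : e v ≤ 0 := by
        have : ¬ 1 ≤ e v := he
        omega
      obtain ⟨n, hn⟩ : ∃ n : ℕ, e v = -n := ⟨(-e v).toNat, by omega⟩
      refine ⟨n, AddMonoidAlgebra.single (e.update v (-e v)) c,
        Laurent.supportedIn_single ?_ c, ?_⟩
      · simpa using he'
      · rw [hsingle, hn, ← mul_assoc, zpow_neg, zpow_natCast, mul_inv_cancel₀ (pow_ne_zero n hιp0),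
          one_mul]
  refine ⟨f₁, f - p * f₁, by ring, ?_⟩
  have h1 : p ^ N * (f - p * f₁) = f₂ := by
    apply hι
    rw [hf₂', map_mul, map_sub, hf₁, ← hg, map_add, map_pow, add_sub_cancel_left]
  have h2 : (p ^ N * (f - p * f₁)).IsPolynomialIn v := by rw [h1]; exact hf₂
  clear h1 hf₂'
  induction N with
  | zero => simpa using h2
  | succ N ih =>
    rw [pow_succ', mul_assoc] at h2
    exact ih (Laurent.IsPolynomialIn.of_mul hp0 hp h2)

variable [Quiver.{w} V] (S : Finset V) (a : S → ℤˣ)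

/-- A variable is polyamorous precisely when its exchange binomial specialises to `0`. -/
theorem isPolyamorousVariable_iff (hq : IsTwoAcyclic (arrowCount V)) (v : {v : V // v ∉ S}) :
    IsPolyamorousVariable V S a v ↔ specialise S a (exchangePoly (arrowCount V) v) = 0 := by
  have hp := initialSeed_isProper hq
  constructor
  · intro h
    by_contra h0
    have hinv : algebraMap (Laurent V) (FunField V)
        (AddMonoidAlgebra.single (Finsupp.single (v : V) (-1)) 1) =
          ((initialSeed V).cluster v)⁻¹ := by
      refine eq_inv_of_mul_eq_one_left ?_
      change algebraMap _ _ (((Laurent.var (v : V))⁻¹ : (Laurent V)ˣ) : Laurent V) *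
        algebraMap _ _ ((Laurent.var (v : V) : (Laurent V)ˣ) : Laurent V) = _
      rw [← map_mul, Units.inv_mul, map_one]
    -- The specialisation of the cluster variable obtained by mutation at `v`.
    have hvar : algebraMap (Laurent V) (FunField V) (exchangePoly (arrowCount V) v *
        AddMonoidAlgebra.single (Finsupp.single (v : V) (-1)) 1) ∈ clusterAlgebra V :=
      Subring.subset_closure ⟨_, .mutate (initialSeed V) v .initial, v, by
        rw [map_mul, algebraMap_exchangePoly, hinv, Seed.mutate_cluster_self, div_eq_mul_inv]⟩
    have hmem := h _ ⟨_, hvar, rfl⟩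
    obtain ⟨e, he⟩ := Finsupp.support_nonempty_iff.mpr
      (AddMonoidAlgebra.coeff_eq_zero.not.mpr h0)
    have hev : e v = 0 := specialise_supportedIn S a (v := v) (T := {0})
      (exchangePoly_supportedIn hq v) e he
    rw [map_mul, specialise_single] at hmem
    have := hmem (e + (Finsupp.single (v : V) (-1)).subtypeDomain (· ∉ S)) (by
      rw [Finsupp.mem_support_iff, AddMonoidAlgebra.coeff_mul_single_apply, add_neg_cancel_right]
      simpa using he)
    simp [hev] at this
  · rintro h0 _ ⟨f, hf, rfl⟩
    have hmem := clusterAlgebra_le_laurent_mutate hq v hf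
    have hcl : ((initialSeed V).mutate v).cluster = Function.update
        (fun i => algebraMap (Laurent V) (FunField V) (Laurent.var i : (Laurent V)ˣ)) v
          (algebraMap _ _ (exchangePoly (arrowCount V) (v : V)) /
            algebraMap _ _ (Laurent.var (v : V) : (Laurent V)ˣ).val) := by
      rw [algebraMap_exchangePoly]
      rfl
    rw [Seed.laurent, hcl] at hmem
    obtain ⟨g, h, rfl, hh⟩ := exists_dvd_isPolynomialIn_of_mem_laurent
      (IsFractionRing.injective _ _) (exchangePoly_ne_zero _ _)
      (exchangePoly_supportedIn hq v) hmem
    have h1 := specialise_supportedIn S a (v := v) (T := {n | 0 ≤ n}) hh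
    change Laurent.IsPolynomialIn (specialise S a _) v
    rw [map_add, map_mul, h0, zero_mul, zero_add]
    exact h1

end Polyamorous

end ClusterPoly

theorem mainTheorem4 {V : Type u} [Fintype V] [DecidableEq V] [Quiver.{w} V]
    [∀ i j : V, Finite (i ⟶ j)]
    (hloop : ∀ i : V, IsEmpty (i ⟶ i))
    (hcycle : ∀ i j : V, IsEmpty (i ⟶ j) ∨ IsEmpty (j ⟶ i))
    (S : Finset V) (a : S → ℤˣ) (s : S → ZMod 2) (hs : ∀ j, a j = (-1) ^ (s j).val) :
    ClusterPoly.IsPolyamorous V S a ↔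
      (ClusterPoly.underlyingGraph V).IsIndepSet {v | v ∉ S} ∧
        (ClusterPoly.specialisationMatrix V S).mulVec s = fun _ => 1 := by
  have harr : ∀ i j : V, ClusterPoly.arrowCount V i j = 0 ↔ ¬ Nonempty (i ⟶ j) := fun i j => by
    rw [ClusterPoly.arrowCount, Finite.card_eq_zero_iff, not_nonempty_iff]
  have hq : ClusterPoly.IsTwoAcyclic (ClusterPoly.arrowCount V) := fun i j => by
    simpa only [harr, not_nonempty_iff] using hcycle i j
  have hrow : ∀ v : {v : V // v ∉ S},
      ClusterPoly.specialise S a (ClusterPoly.exchangePoly (ClusterPoly.arrowCount V) v) = 0 ↔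
        (∀ i ∉ S, ClusterPoly.arrowCount V i v = 0 ∧ ClusterPoly.arrowCount V v i = 0) ∧
          (ClusterPoly.specialisationMatrix V S).mulVec s v = 1 := fun v => by
    rw [ClusterPoly.specialise_exchangePoly_eq_zero_iff S a hq,
      ClusterPoly.specialisationSign_eq_neg_iff S a s hs]
    rfl
  have hall : ClusterPoly.IsPolyamorous V S a ↔ ∀ v : {v : V // v ∉ S},
      (∀ i ∉ S, ClusterPoly.arrowCount V i v = 0 ∧ ClusterPoly.arrowCount V v i = 0) ∧
        (ClusterPoly.specialisationMatrix V S).mulVec s v = 1 :=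
    forall_congr' fun v => (ClusterPoly.isPolyamorousVariable_iff S a hq v).trans (hrow v)
  rw [hall, forall_and, funext_iff]
  refine and_congr_left fun _ => ⟨fun h i hi j hj _ hadj => ?_, fun h v i hi => ?_⟩
  · have := h ⟨j, hj⟩ i hi
    rw [harr, harr] at this
    rcases ((SimpleGraph.fromRel_adj _ _ _).mp hadj).2 with h' | h'
    · exact this.1 h'
    · exact this.2 h'
  · rw [harr, harr]
    by_cases hiv : i = v
    · subst hiv
      exact ⟨not_nonempty_iff.mpr (hloop _), not_nonempty_iff.mpr (hloop _)⟩
    · have := h hi v.2 hiv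
      rw [ClusterPoly.underlyingGraph, SimpleGraph.fromRel_adj] at this
      tauto
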